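/- Let $d \ge 2$ be a fixed integer. In the unipoint model, an uncertain set of $n \ge 1$ points in $\mathbb{R}^d$ consists of sites $p_1,\dots,p_n \in \mathbb{R}^d$ with existence probabilities $\pi_1,\dots,\pi_n \in (0,1]$; the sites exist independently, so that the outcome $B \subseteq \{1,\dots,n\}$ (the set of the indices of the existing sites) has probability $\Pr(B)=\prod_{i\in B}\pi_i\prod_{i\notin B}(1-\pi_i)$. The membership probability of a point $q \in \mathbb{R}^d$ is $$\mu(q)=\sum_{B\subseteq\{1,\dots,n\},\ q\in \mathrm{conv}\{p_i : i\in B\}}\Pr(B).$$ The $n+1$ points $p_1,\dots,p_n,q$ are in general position if, for all $2\le k\le d$, no $k+1$ of them lie on a common hyperplane (of dimension $k-1$) of $\mathbb{R}^k$ after projection to any $k$ of the $d$ coordinates. Theorem. There are a real RAM program and a constant $C$, both depending only on $d$, such that for every $n\ge 1$ and every input $(p_1,\pi_1),\dots,(p_n,\pi_n),q$ with $p_1,\dots,p_n,q$ in general position, the program computes $\mu(q)$ exactly in at most $C n^d$ steps, using at most $C n$ memory cells for words and at most $C n$ memory cells for real numbers (input included), besides a constant number of registers. That is, $\mu(q)$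 can be computed in $O(n^d)$ time and linear space. Here a real RAM performs in one step an exact operation $+,-,\times,/$ or a comparison on real numbers, an operation $+,-,\times$ (with $-$ truncated at $0$) or a comparison on words (natural numbers smaller than $Cn$, i.e. of $O(\log n)$ bits), the setting or copying of a register, or a read or write of a memory cell whose address is in a word register. -/

import Mathlib

/-! ### Uncertain points in the unipoint model -/

namespace Unipoint

/-- Probability of the outcome `B`: site `i` exists with probability `pr i`, independently of the
other sites, and `B` is the set of the (indices of the) sites that exist. -/
noncomputable def outcomeProb {n : ℕ} (pr : Fin n → ℝ) (B : Finset (Fin n)) : ℝ :=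
  (∏ i ∈ B, pr i) * ∏ i ∈ Bᶜ, (1 - pr i)

open Classical in
/-- Membership probability of `q`: the total probability of the outcomes whose convex hull
contains `q`. -/
noncomputable def membershipProb {n d : ℕ} (site : Fin n → Fin d → ℝ) (pr : Fin n → ℝ)
    (q : Fin d → ℝ) : ℝ :=
  ∑ B ∈ Finset.univ.filter
    (fun B : Finset (Fin n) => q ∈ convexHull ℝ (site '' (B : Set (Fin n)))), outcomeProb pr B

/-- General position of a family of points of `ℝ^d`: for `2 ≤ k ≤ d`, no `k + 1` of the points lie
on a common hyperplane `{y | ∑ i, a i * y i = b}` of `ℝ^k` after projection to `k` of the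
coordinates. -/
def GeneralPosition {ι : Type*} {d : ℕ} (x : ι → Fin d → ℝ) : Prop :=
  ∀ k : ℕ, 2 ≤ k → k ≤ d → ∀ (c : Fin k ↪ Fin d) (s : Fin (k + 1) ↪ ι) (a : Fin k → ℝ) (b : ℝ),
    a ≠ 0 → ¬ ∀ j, ∑ i, a i * x (s j) (c i) = b

/-- The family consisting of the sites and the query point. -/
def withQuery {n d : ℕ} (site : Fin n → Fin d → ℝ) (q : Fin d → ℝ) : Option (Fin n) → Fin d → ℝ
  | none => q
  | some i => site i

end Unipoint

/-! ### The real RAM -/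

namespace RealRAM

/-- A configuration of the machine: registers and a random access memory for words (natural numbers
of bounded size), and registers and a random access memory for real numbers. Registers are named in
the program text; memory cells are addressed by the content of a word register. -/
structure State where
  wreg : ℕ → ℕ
  rreg : ℕ → ℝ
  wmem : ℕ → ℕ
  rmem : ℕ → ℝ

/-- The instructions. Real constants in a program are rational; there is no rounding, and
no conversion of reals into words. -/
inductive Instr where
  | wconst (i c : ℕ)
  | wcopy (i j : ℕ)
  | wadd (i j k : ℕ)
  | wsub (i j k : ℕ)
  | wmul (i j k : ℕ)
  | wload (i j : ℕ)
  | wstore (i j : ℕ)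
  | rconst (i : ℕ) (c : ℚ)
  | rcopy (i j : ℕ)
  | radd (i j k : ℕ)
  | rsub (i j k : ℕ)
  | rmul (i j k : ℕ)
  | rdiv (i j k : ℕ)
  | rload (i j : ℕ)
  | rstore (i j : ℕ)

namespace State

def setW (s : State) (i v : ℕ) : State := { s with wreg := Function.update s.wreg i v }

noncomputable def setR (s : State) (i : ℕ) (v : ℝ) : State :=
  { s with rreg := Function.update s.rreg i v }

def setWMem (s : State) (a v : ℕ) : State := { s with wmem := Function.update s.wmem a v }

noncomputable def setRMem (s : State) (a : ℕ) (v : ℝ) : State :=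
  { s with rmem := Function.update s.rmem a v }

end State

/-- Effect of an instruction; `wload i j` and `rload i j` read the cell whose address is in word
register `j`, and `wstore i j` and `rstore i j` write register `j` to the cell whose address is in
word register `i`. -/
noncomputable def Instr.eval : Instr → State → State
  | wconst i c, s => s.setW i c
  | wcopy i j, s => s.setW i (s.wreg j)
  | wadd i j k, s => s.setW i (s.wreg j + s.wreg k)
  | wsub i j k, s => s.setW i (s.wreg j - s.wreg k)
  | wmul i j k, s => s.setW i (s.wreg j * s.wreg k)
  | wload i j, s => s.setW i (s.wmem (s.wreg j))
  | wstore i j, s => s.setWMem (s.wreg i) (s.wreg j)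
  | rconst i c, s => s.setR i (c : ℝ)
  | rcopy i j, s => s.setR i (s.rreg j)
  | radd i j k, s => s.setR i (s.rreg j + s.rreg k)
  | rsub i j k, s => s.setR i (s.rreg j - s.rreg k)
  | rmul i j k, s => s.setR i (s.rreg j * s.rreg k)
  | rdiv i j k, s => s.setR i (s.rreg j / s.rreg k)
  | rload i j, s => s.setR i (s.rmem (s.wreg j))
  | rstore i j, s => s.setRMem (s.wreg i) (s.rreg j)

/-- The instruction can be executed on a machine with `M` memory cells of each kind, whose words
are the numbers below `M` (just large enough for an address): it addresses only existing
cells, produces no word outside that range, and does not divide by zero. Otherwise the machine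
is stuck. -/
def Instr.Ok (M : ℕ) : Instr → State → Prop
  | wconst _ c, _ => c < M
  | wcopy _ j, s => s.wreg j < M
  | wadd _ j k, s => s.wreg j + s.wreg k < M
  | wsub _ j k, s => s.wreg j - s.wreg k < M
  | wmul _ j k, s => s.wreg j * s.wreg k < M
  | wload _ j, s => s.wreg j < M ∧ s.wmem (s.wreg j) < M
  | wstore i j, s => s.wreg i < M ∧ s.wreg j < M
  | rconst _ _, _ => True
  | rcopy _ _, _ => True
  | radd _ _ _, _ => True
  | rsub _ _ _, _ => True
  | rmul _ _ _, _ => True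
  | rdiv _ _ k, s => s.rreg k ≠ 0
  | rload _ j, s => s.wreg j < M
  | rstore i _, s => s.wreg i < M

/-- Comparisons of two registers. -/
inductive Test where
  | wlt (i j : ℕ)
  | weq (i j : ℕ)
  | rlt (i j : ℕ)
  | req (i j : ℕ)

def Test.Holds : Test → State → Prop
  | wlt i j, s => s.wreg i < s.wreg j
  | weq i j, s => s.wreg i = s.wreg j
  | rlt i j, s => s.rreg i < s.rreg j
  | req i j, s => s.rreg i = s.rreg j

/-- Programs. A program is a finite object, so it uses only finitely many registers. -/
inductive Program where
  | skip
  | instr (i : Instr)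
  | seq (P Q : Program)
  | ite (b : Test) (P Q : Program)
  | loop (b : Test) (P : Program)

/-- `Exec M P s t s'`: on a machine with `M` memory cells of each kind (and words below `M`), the
program `P` started in configuration `s` halts after `t` steps in configuration `s'`. Every
instruction and every evaluation of a test is one step. `loop b P` repeats `P` while `b` holds. -/
inductive Exec (M : ℕ) : Program → State → ℕ → State → Prop where
  | skip (s : State) : Exec M .skip s 1 s
  | instr (i : Instr) (s : State) : i.Ok M s → Exec M (.instr i) s 1 (i.eval s)
  | seq {P Q : Program} {s s₁ s₂ : State} {t₁ t₂ : ℕ} :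
      Exec M P s t₁ s₁ → Exec M Q s₁ t₂ s₂ → Exec M (.seq P Q) s (t₁ + t₂) s₂
  | ite_true {b : Test} {P Q : Program} {s s₁ : State} {t : ℕ} :
      b.Holds s → Exec M P s t s₁ → Exec M (.ite b P Q) s (1 + t) s₁
  | ite_false {b : Test} {P Q : Program} {s s₁ : State} {t : ℕ} :
      ¬ b.Holds s → Exec M Q s t s₁ → Exec M (.ite b P Q) s (1 + t) s₁
  | loop_true {b : Test} {P : Program} {s s₁ s₂ : State} {t₁ t₂ : ℕ} :
      b.Holds s → Exec M P s t₁ s₁ → Exec M (.loop b P) s₁ t₂ s₂ →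
      Exec M (.loop b P) s (1 + t₁ + t₂) s₂
  | loop_false {b : Test} {P : Program} {s : State} :
      ¬ b.Holds s → Exec M (.loop b P) s 1 s

/-- The configuration `s` holds the input: `n` is in word register `0`; the real memory holds, one
site after the other, the `d` coordinates and the probability of each site, followed by the `d`
coordinates of the query point. Nothing is known about the other registers and cells. -/
structure HoldsInput {n d : ℕ} (site : Fin n → Fin d → ℝ) (pr : Fin n → ℝ) (q : Fin d → ℝ)
    (s : State) : Prop where
  size : s.wreg 0 = n
  site : ∀ (i : Fin n) (c : Fin d), s.rmem (i * (d + 1) + c) = site i c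
  pr : ∀ i : Fin n, s.rmem (i * (d + 1) + d) = pr i
  query : ∀ c : Fin d, s.rmem (n * (d + 1) + c) = q c

end RealRAM

/-! ### Loop expressions and their compilation -/

namespace RealRAM

/-! Translate the query point to the origin and compute the probability that the hull of the
existing vectors avoids it. Split an outcome `B` in `ℝ^(p+2)` by its projection that forgets two
coordinates. If the projected hull avoids `0`, so does the hull. Otherwise the cone of `B` meets the
plane of the two forgotten coordinates outside `0`. If the hull of `B` avoids `0`, this intersection
is a pointed planar cone, so it has exactly one extreme ray in a fixed sense of rotation. In general
position that ray is interior to a facet of the cone spanned by exactly `p + 1` vectors of `B`.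
Conversely, such a facet forces the hull to avoid `0`.

So the avoidance probability in `ℝ^(p+2)` is the one in `ℝ^p` plus the sum, over increasing
`(p+1)`-tuples, of the probability that the tuple spans the extreme facet (`avoidProb_add_two`, from
`exists_isExtremeFacet`, `IsExtremeFacet.unique` and `IsExtremeFacet.zero_notMem`). By independence
each summand is a product over the sites: the members of the tuple exist, and the sites on the wrong
side of its hyperplane do not. There are `n^(p+1)` tuples and each product takes `O(n)` steps, so
every level of the recursion costs at most `O(n^d)`. The recursion ends in dimension `0` or `1`.

General position says nothing about projections to one coordinate, which the recursion reaches for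
odd `d`. A shear that mixes the last two coordinates makes the last coordinate of every vector
nonzero, and it changes neither membership nor the other genericity conditions. The case `n = 1`,
about which general position says nothing, is treated apart.

The formula is an arithmetic expression with sums and products over the sites. Compiling it gives
nested loops that use only registers and read the input without ever writing to memory, so space is
linear and time is `n` to the nesting depth (`runs_compile`, `exists_cost_le`). -/

/-- `Runs M P s T Q`: started in `s`, the program `P` halts after at most `T` steps in a
configuration that satisfies `Q`. -/
def Runs (M : ℕ) (P : Program) (s : State) (T : ℕ) (Q : State → Prop) : Prop :=
  ∃ t s', Exec M P s t s' ∧ t ≤ T ∧ Q s'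

namespace Runs

variable {M : ℕ} {P P' : Program} {s : State} {T T' : ℕ} {Q Q' : State → Prop}

theorem instr {i : Instr} (hi : i.Ok M s) (h : Q (i.eval s)) : Runs M (.instr i) s 1 Q :=
  ⟨1, _, .instr i s hi, le_rfl, h⟩

theorem seq (h : Runs M P s T Q') (h' : ∀ s₁, Q' s₁ → Runs M P' s₁ T' Q) :
    Runs M (.seq P P') s (T + T') Q := by
  obtain ⟨t, s₁, he, ht, hq⟩ := h
  obtain ⟨t', s₂, he', ht', hq'⟩ := h' s₁ hq
  exact ⟨_, s₂, .seq he he', by omega, hq'⟩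

theorem ite {b : Test} (h : b.Holds s → Runs M P s T Q) (h' : ¬ b.Holds s → Runs M P' s T' Q) :
    Runs M (.ite b P P') s (1 + T + T') Q := by
  by_cases hb : b.Holds s
  · obtain ⟨t, s₁, he, ht, hq⟩ := h hb
    exact ⟨_, s₁, .ite_true hb he, by omega, hq⟩
  · obtain ⟨t, s₁, he, ht, hq⟩ := h' hb
    exact ⟨_, s₁, .ite_false hb he, by omega, hq⟩

theorem mono (h : Runs M P s T Q') (hT : T ≤ T') (hQ : ∀ s', Q' s' → Q s') :
    Runs M P s T' Q := by
  obtain ⟨t, s₁, he, ht, hq⟩ := h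
  exact ⟨t, s₁, he, ht.trans hT, hQ _ hq⟩

/-- Total correctness of a counting loop, by an invariant. -/
theorem loop {b : Test} {n : ℕ} {Inv : ℕ → State → Prop}
    (hb : ∀ i s, Inv i s → (b.Holds s ↔ i < n))
    (hP : ∀ i s, i < n → Inv i s → Runs M P s T (Inv (i + 1))) :
    ∀ (k i : ℕ) (s : State), i + k = n → Inv i s →
      Runs M (.loop b P) s (k * (T + 1) + 1) (Inv n) := by
  intro k
  induction k with
  | zero =>
    intro i s hi hs
    obtain rfl : i = n := by omega
    exact ⟨1, s, .loop_false (by rw [hb _ _ hs]; omega), by omega, hs⟩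
  | succ k ih =>
    intro i s hi hs
    obtain ⟨t, s₁, he, ht, hq⟩ := hP i s (by omega) hs
    obtain ⟨t', s₂, he', ht', hq'⟩ := ih (i + 1) s₁ (by omega) hq
    refine ⟨_, s₂, .loop_true ((hb _ _ hs).2 (by omega)) he he', ?_, hq'⟩
    rw [Nat.succ_mul]; omega

end Runs

/-- Arithmetic expressions over an input in the unipoint model, with loops over the sites.
`Expr d a` has `a` free site variables. -/
inductive Expr (d : ℕ) : ℕ → Type
  | const {a : ℕ} (c : ℚ) : Expr d a
  /-- A real parameter. -/
  | param {a : ℕ} : Expr d a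
  | coord {a : ℕ} (i : Fin a) (c : Fin d) : Expr d a
  | prob {a : ℕ} (i : Fin a) : Expr d a
  | query {a : ℕ} (c : Fin d) : Expr d a
  | add {a : ℕ} (x y : Expr d a) : Expr d a
  | sub {a : ℕ} (x y : Expr d a) : Expr d a
  | mul {a : ℕ} (x y : Expr d a) : Expr d a
  /-- Quotient, with value `0` if the denominator vanishes. -/
  | div {a : ℕ} (x y : Expr d a) : Expr d a
  /-- Sum over all sites. -/
  | sum {a : ℕ} (x : Expr d (a + 1)) : Expr d a
  /-- Product over all sites. -/
  | prod {a : ℕ} (x : Expr d (a + 1)) : Expr d a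
  | ifPos {a : ℕ} (c x y : Expr d a) : Expr d a
  | ifLt {a : ℕ} (i j : Fin a) (x y : Expr d a) : Expr d a
  | ifEq {a : ℕ} (i j : Fin a) (x y : Expr d a) : Expr d a
  /-- Test whether there is only one site. -/
  | ifOne {a : ℕ} (x y : Expr d a) : Expr d a

namespace Expr

variable {d n : ℕ}

/-- Value of an expression. -/
noncomputable def eval (site : Fin n → Fin d → ℝ) (pr : Fin n → ℝ) (q : Fin d → ℝ) (τ : ℝ) :
    {a : ℕ} → Expr d a → (Fin a → Fin n) → ℝ
  | _, const c, _ => c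
  | _, param, _ => τ
  | _, coord i c, ρ => site (ρ i) c
  | _, prob i, ρ => pr (ρ i)
  | _, query c, _ => q c
  | _, add x y, ρ => eval site pr q τ x ρ + eval site pr q τ y ρ
  | _, sub x y, ρ => eval site pr q τ x ρ - eval site pr q τ y ρ
  | _, mul x y, ρ => eval site pr q τ x ρ * eval site pr q τ y ρ
  | _, div x y, ρ => eval site pr q τ x ρ / eval site pr q τ y ρ
  | _, sum x, ρ => ∑ i, eval site pr q τ x (Fin.snoc ρ i)
  | _, prod x, ρ => ∏ i, eval site pr q τ x (Fin.snoc ρ i)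
  | _, ifPos c x y, ρ =>
      if 0 < eval site pr q τ c ρ then eval site pr q τ x ρ else eval site pr q τ y ρ
  | _, ifLt i j x y, ρ => if ρ i < ρ j then eval site pr q τ x ρ else eval site pr q τ y ρ
  | _, ifEq i j x y, ρ => if ρ i = ρ j then eval site pr q τ x ρ else eval site pr q τ y ρ
  | _, ifOne x y, ρ => if n = 1 then eval site pr q τ x ρ else eval site pr q τ y ρ

/-- Compilation of an expression. The result is left in real register `m`, and real registers below
`m` are unchanged. Word registers `0`, `1`, `2` hold the number of sites, `1` and `d + 1`,
word register `3 + i` holds site variable `i`, and real register `0` holds the parameter. -/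
def compile : {a : ℕ} → Expr d a → ℕ → Program
  | _, const c, m => .instr (.rconst m c)
  | _, param, m => .instr (.rcopy m 0)
  | a, coord i c, m =>
      .seq (.instr (.wmul (3 + a) (3 + i) 2)) (.seq (.instr (.wconst (4 + a) c))
        (.seq (.instr (.wadd (3 + a) (3 + a) (4 + a))) (.instr (.rload m (3 + a)))))
  | a, prob i, m =>
      .seq (.instr (.wmul (3 + a) (3 + i) 2)) (.seq (.instr (.wconst (4 + a) d))
        (.seq (.instr (.wadd (3 + a) (3 + a) (4 + a))) (.instr (.rload m (3 + a)))))
  | a, query c, m =>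
      .seq (.instr (.wmul (3 + a) 0 2)) (.seq (.instr (.wconst (4 + a) c))
        (.seq (.instr (.wadd (3 + a) (3 + a) (4 + a))) (.instr (.rload m (3 + a)))))
  | _, add x y, m => .seq (compile x m) (.seq (compile y (m + 1)) (.instr (.radd m m (m + 1))))
  | _, sub x y, m => .seq (compile x m) (.seq (compile y (m + 1)) (.instr (.rsub m m (m + 1))))
  | _, mul x y, m => .seq (compile x m) (.seq (compile y (m + 1)) (.instr (.rmul m m (m + 1))))
  | _, div x y, m => .seq (compile x m) (.seq (compile y (m + 1)) (.seq (.instr (.rconst (m + 2) 0))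
      (.ite (.req (m + 1) (m + 2)) (.instr (.rconst m 0)) (.instr (.rdiv m m (m + 1))))))
  | a, sum x, m => .seq (.instr (.rconst m 0)) (.seq (.instr (.wconst (3 + a) 0))
      (.loop (.wlt (3 + a) 0) (.seq (compile x (m + 1))
        (.seq (.instr (.radd m m (m + 1))) (.instr (.wadd (3 + a) (3 + a) 1))))))
  | a, prod x, m => .seq (.instr (.rconst m 1)) (.seq (.instr (.wconst (3 + a) 0))
      (.loop (.wlt (3 + a) 0) (.seq (compile x (m + 1))
        (.seq (.instr (.rmul m m (m + 1))) (.instr (.wadd (3 + a) (3 + a) 1))))))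
  | _, ifPos c x y, m => .seq (compile c m) (.seq (.instr (.rconst (m + 1) 0))
      (.ite (.rlt (m + 1) m) (compile x m) (compile y m)))
  | _, ifLt i j x y, m => .ite (.wlt (3 + i) (3 + j)) (compile x m) (compile y m)
  | _, ifEq i j x y, m => .ite (.weq (3 + i) (3 + j)) (compile x m) (compile y m)
  | _, ifOne x y, m => .ite (.weq 0 1) (compile x m) (compile y m)

/-- Bound on the number of steps of the compiled expression, for `n` sites. -/
def cost (n : ℕ) : {a : ℕ} → Expr d a → ℕ
  | _, const _ => 1
  | _, param => 1
  | _, coord _ _ => 4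
  | _, prob _ => 4
  | _, query _ => 4
  | _, add x y => cost n x + (cost n y + 1)
  | _, sub x y => cost n x + (cost n y + 1)
  | _, mul x y => cost n x + (cost n y + 1)
  | _, div x y => cost n x + (cost n y + 4)
  | _, sum x => 2 + (n * (cost n x + 3) + 1)
  | _, prod x => 2 + (n * (cost n x + 3) + 1)
  | _, ifPos c x y => cost n c + (1 + (1 + cost n x + cost n y))
  | _, ifLt _ _ x y => 1 + cost n x + cost n y
  | _, ifEq _ _ x y => 1 + cost n x + cost n y
  | _, ifOne x y => 1 + cost n x + cost n y

/-- Nesting depth of the loops. -/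
def depth : {a : ℕ} → Expr d a → ℕ
  | _, const _ => 0
  | _, param => 0
  | _, coord _ _ => 0
  | _, prob _ => 0
  | _, query _ => 0
  | _, add x y => max (depth x) (depth y)
  | _, sub x y => max (depth x) (depth y)
  | _, mul x y => max (depth x) (depth y)
  | _, div x y => max (depth x) (depth y)
  | _, sum x => depth x + 1
  | _, prod x => depth x + 1
  | _, ifPos c x y => max (depth c) (max (depth x) (depth y))
  | _, ifLt _ _ x y => max (depth x) (depth y)
  | _, ifEq _ _ x y => max (depth x) (depth y)
  | _, ifOne x y => max (depth x) (depth y)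

/-- Each loop multiplies the cost by `n` up to lower-order terms, which `K` absorbs because `1 ≤ n`.
Branches of a test are charged both, so depths combine by `max`. -/
theorem exists_cost_le {a : ℕ} (e : Expr d a) :
    ∃ K, ∀ n, 1 ≤ n → cost n e ≤ K * n ^ depth e := by
  have key : ∀ {D D' K x n : ℕ}, 1 ≤ n → D ≤ D' → x ≤ K * n ^ D → x ≤ K * n ^ D' :=
    fun hn hD hx => hx.trans (Nat.mul_le_mul_left _ (Nat.pow_le_pow_right hn hD))
  have two : ∀ {D D' r : ℕ} {x y : ℕ → ℕ}, (∃ K, ∀ n, 1 ≤ n → x n ≤ K * n ^ D) →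
      (∃ K, ∀ n, 1 ≤ n → y n ≤ K * n ^ D') →
      ∃ K, ∀ n, 1 ≤ n → x n + y n + r ≤ K * n ^ max D D' := by
    rintro D D' r x y ⟨K, hK⟩ ⟨K', hK'⟩
    refine ⟨K + K' + r, fun n hn => ?_⟩
    have h1 := key hn (le_max_left D D') (hK n hn)
    have h2 := key hn (le_max_right D D') (hK' n hn)
    have h3 : 1 ≤ n ^ max D D' := Nat.one_le_pow _ _ hn
    nlinarith
  have loop : ∀ {D : ℕ} {x : ℕ → ℕ}, (∃ K, ∀ n, 1 ≤ n → x n ≤ K * n ^ D) →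
      ∃ K, ∀ n, 1 ≤ n → 2 + (n * (x n + 3) + 1) ≤ K * n ^ (D + 1) := by
    rintro D x ⟨K, hK⟩
    refine ⟨K + 6, fun n hn => ?_⟩
    have h3 : 1 ≤ n ^ D := Nat.one_le_pow _ _ hn
    have h4 : n * x n ≤ n * (K * n ^ D) := Nat.mul_le_mul_left _ (hK n hn)
    rw [pow_succ]
    nlinarith
  induction e with
  | const | param | coord | prob | query => exact ⟨4, fun n _ => by simp [cost, depth]⟩
  | add x y hx hy | sub x y hx hy | mul x y hx hy =>
    obtain ⟨K, hK⟩ := two (r := 1) hx hy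
    exact ⟨K, fun n hn => by simpa [cost, depth, add_assoc] using hK n hn⟩
  | div x y hx hy =>
    obtain ⟨K, hK⟩ := two (r := 4) hx hy
    exact ⟨K, fun n hn => by simpa [cost, depth, add_assoc] using hK n hn⟩
  | sum x hx | prod x hx => exact loop hx
  | ifPos c x y hc hx hy =>
    obtain ⟨K, hK⟩ := two (r := 0) hc (two (r := 2) hx hy)
    exact ⟨K, fun n hn => le_trans (by simp only [cost]; omega) (hK n hn)⟩
  | ifLt _ _ x y hx hy | ifEq _ _ x y hx hy | ifOne x y hx hy =>
    obtain ⟨K, hK⟩ := two (r := 1) hx hy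
    exact ⟨K, fun n hn => le_trans (by simp only [cost]; omega) (hK n hn)⟩

/-- What the compiled expressions assume about the configuration. -/
structure Ctx (site : Fin n → Fin d → ℝ) (pr : Fin n → ℝ) (q : Fin d → ℝ) (τ : ℝ) {a : ℕ}
    (ρ : Fin a → Fin n) (s : State) : Prop where
  input : HoldsInput site pr q s
  one : s.wreg 1 = 1
  stride : s.wreg 2 = d + 1
  var : ∀ i : Fin a, s.wreg (3 + i) = ρ i
  param : s.rreg 0 = τ

/-- `s'` agrees with `s` on the word registers below `3 + a`, the real registers below `m` and
the real memory. -/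
structure Frame (a m : ℕ) (s s' : State) : Prop where
  wreg : ∀ i < 3 + a, s'.wreg i = s.wreg i
  rreg : ∀ i < m, s'.rreg i = s.rreg i
  rmem : s'.rmem = s.rmem

theorem Frame.trans {a a' m m' : ℕ} {s s' s'' : State} (h : Frame a m s s')
    (h' : Frame a' m' s' s'') (ha : a ≤ a') (hm : m ≤ m') : Frame a m s s'' where
  wreg i hi := (h'.wreg i (by omega)).trans (h.wreg i hi)
  rreg i hi := (h'.rreg i (by omega)).trans (h.rreg i hi)
  rmem := h'.rmem.trans h.rmem

variable {site : Fin n → Fin d → ℝ} {pr : Fin n → ℝ} {q : Fin d → ℝ} {τ : ℝ}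

/-- The condition `1 ≤ m` protects real register `0`, which holds the parameter. -/
theorem Ctx.frame {a m : ℕ} {ρ : Fin a → Fin n} {s s' : State} (h : Ctx site pr q τ ρ s)
    (hf : Frame a m s s') (hm : 1 ≤ m) : Ctx site pr q τ ρ s' where
  input :=
    { size := (hf.wreg 0 (by omega)).trans h.input.size
      site := by rw [hf.rmem]; exact h.input.site
      pr := by rw [hf.rmem]; exact h.input.pr
      query := by rw [hf.rmem]; exact h.input.query }
  one := (hf.wreg 1 (by omega)).trans h.one
  stride := (hf.wreg 2 (by omega)).trans h.stride
  var i := (hf.wreg _ (by omega)).trans (h.var i)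
  param := (hf.rreg 0 (by omega)).trans h.param

/-- Reading the cell `c` of the record number `v`, where `v` is in word register `w`. -/
theorem runs_read {M a m w c v : ℕ} {s : State} (hM : v * (d + 1) + c < M) (hc : c < M)
    (hv : s.wreg w = v) (h2 : s.wreg 2 = d + 1) :
    Runs M (.seq (.instr (.wmul (3 + a) w 2)) (.seq (.instr (.wconst (4 + a) c))
        (.seq (.instr (.wadd (3 + a) (3 + a) (4 + a))) (.instr (.rload m (3 + a)))))) s 4
      (fun s' => Frame a m s s' ∧ s'.rreg m = s.rmem (v * (d + 1) + c)) := by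
  have h34 : 3 + a ≠ 4 + a := by omega
  refine Runs.seq (T := 1) (T' := 3) (Q' := fun s' => s' = _) (Runs.instr ?_ rfl) ?_
  · simp only [Instr.Ok, hv, h2]; omega
  rintro _ rfl
  refine Runs.seq (T := 1) (T' := 2) (Q' := fun s' => s' = _) (Runs.instr ?_ rfl) ?_
  · simpa only [Instr.Ok]
  rintro _ rfl
  refine Runs.seq (T := 1) (T' := 1) (Q' := fun s' => s' = _) (Runs.instr ?_ rfl) ?_
  · simpa [Instr.Ok, Instr.eval, State.setW, h34, hv, h2]
  rintro _ rfl
  refine Runs.instr ?_ ⟨⟨?_, ?_, ?_⟩, ?_⟩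
  · simpa [Instr.Ok, Instr.eval, State.setW, h34, hv, h2]
  · intro i hi
    have h3 : i ≠ 3 + a := by omega
    have h4 : i ≠ 4 + a := by omega
    simp [Instr.eval, State.setW, State.setR, h3, h4]
  · intro i hi
    simp [Instr.eval, State.setW, State.setR, hi.ne]
  · simp [Instr.eval, State.setW, State.setR]
  · simp [Instr.eval, State.setW, State.setR, hv, h2]

/-- Evaluating two expressions and combining the results by one instruction. -/
theorem runs_binary {M a m T T' : ℕ} {P P' : Program} {s : State} {vx vy v : ℝ} {i : Instr}
    (hx : Runs M P s T (fun s' => Frame a m s s' ∧ s'.rreg m = vx))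
    (hy : ∀ s', Frame a m s s' →
      Runs M P' s' T' (fun s'' => Frame a (m + 1) s' s'' ∧ s''.rreg (m + 1) = vy))
    (hok : ∀ s, i.Ok M s)
    (hi : ∀ s, s.rreg m = vx → s.rreg (m + 1) = vy → i.eval s = s.setR m v) :
    Runs M (.seq P (.seq P' (.instr i))) s (T + (T' + 1))
      (fun s' => Frame a m s s' ∧ s'.rreg m = v) := by
  refine hx.seq fun s₁ ⟨hf, h1⟩ => (hy s₁ hf).seq fun s₂ ⟨hf', h2⟩ => Runs.instr (hok _) ?_
  rw [hi s₂ ((hf'.rreg m (by omega)).trans h1) h2]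
  refine ⟨(hf.trans hf' le_rfl (by omega)).trans ⟨?_, ?_, ?_⟩ le_rfl le_rfl, ?_⟩
  · intro i hi; simp [State.setR]
  · intro i hi; simp [State.setR, hi.ne]
  · simp [State.setR]
  · simp [State.setR]

/-- A loop over the sites that combines the values of an expression. -/
theorem runs_fold {M a m T : ℕ} {P : Program} {ρ : Fin a → Fin n} {s : State}
    {val : Fin n → ℝ} {i : Instr} {c : ℚ} (F : ℕ → ℝ) (hm : 1 ≤ m) (hM : n < M)
    (hs : Ctx site pr q τ ρ s) (h0 : F 0 = c)
    (hP : ∀ (x : Fin n) (s : State), Ctx site pr q τ (Fin.snoc ρ x : Fin (a + 1) → Fin n) s →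
      Runs M P s T (fun s' => Frame (a + 1) (m + 1) s s' ∧ s'.rreg (m + 1) = val x))
    (hok : ∀ s, i.Ok M s)
    (hi : ∀ (x : Fin n) s, s.rreg m = F x → s.rreg (m + 1) = val x →
      i.eval s = s.setR m (F (x + 1))) :
    Runs M (.seq (.instr (.rconst m c)) (.seq (.instr (.wconst (3 + a) 0))
      (.loop (.wlt (3 + a) 0) (.seq P (.seq (.instr i) (.instr (.wadd (3 + a) (3 + a) 1)))))))
      s (2 + (n * (T + 3) + 1)) (fun s' => Frame a m s s' ∧ s'.rreg m = F n) := by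
  have ha : ∀ i < 3 + a, i ≠ 3 + a := fun i hi => hi.ne
  rw [show 2 + (n * (T + 3) + 1) = 1 + (1 + (n * (T + 3) + 1)) by ring]
  refine Runs.seq (Q' := fun s' => s' = _) (Runs.instr trivial rfl) ?_
  rintro _ rfl
  refine Runs.seq (Q' := fun s' => s' = _) (Runs.instr (by simp only [Instr.Ok]; omega) rfl) ?_
  rintro _ rfl
  refine Runs.mono (Runs.loop (n := n) (T := T + 2)
    (Inv := fun x s' => Frame a m s s' ∧ s'.wreg (3 + a) = x ∧ s'.rreg m = F x)
    ?_ ?_ n 0 _ (by omega) ?_) le_rfl (fun s' h => ⟨h.1, h.2.2⟩)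
  · rintro x s' ⟨hf, hx, -⟩
    simp [Test.Holds, hx, (hs.frame hf hm).input.size]
  · rintro x s' hx ⟨hf, hx', hF⟩
    have hc := hs.frame hf hm
    have hc' : Ctx site pr q τ (Fin.snoc ρ ⟨x, hx⟩ : Fin (a + 1) → Fin n) s' :=
      -- The loop counter lives in word register `3 + a`, which is exactly the register of the new
      -- last site variable, so the body reads it as such and its frame preserves it.
      ⟨hc.input, hc.one, hc.stride, fun j => by
        refine Fin.lastCases ?_ (fun j => ?_) j
        · simp [hx']
        · simpa using hc.var j, hc.param⟩
    rw [show T + 2 = T + (1 + 1) from rfl]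
    refine (hP ⟨x, hx⟩ s' hc').seq fun s₁ ⟨hf₁, h₁⟩ => ?_
    refine Runs.seq (Q' := fun s' => s' = _) (Runs.instr (hok _) rfl) ?_
    rintro _ rfl
    rw [hi ⟨x, hx⟩ s₁ ((hf₁.rreg m (by omega)).trans hF) h₁]
    have hw : s₁.wreg (3 + a) = x := (hf₁.wreg _ (by omega)).trans hx'
    have h1 : s₁.wreg 1 = 1 := (hf₁.wreg _ (by omega)).trans hc.one
    refine Runs.instr ?_ ⟨(hf.trans hf₁ (by omega) (by omega)).trans ⟨?_, ?_, ?_⟩ le_rfl le_rfl,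
      ?_, ?_⟩
    · simp only [Instr.Ok, State.setR, hw, h1]; omega
    · intro i hi; simp [Instr.eval, State.setR, State.setW, ha i hi]
    · intro i hi; simp [Instr.eval, State.setR, State.setW, hi.ne]
    · simp [Instr.eval, State.setR, State.setW]
    · simp [Instr.eval, State.setR, State.setW, hw, h1]
    · simp [Instr.eval, State.setR, State.setW]
  · refine ⟨⟨?_, ?_, ?_⟩, ?_, ?_⟩
    · intro i hi; simp [Instr.eval, State.setR, State.setW, ha i hi]
    · intro i hi; simp [Instr.eval, State.setR, State.setW, hi.ne]
    · simp [Instr.eval, State.setR, State.setW]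
    · simp [Instr.eval, State.setR, State.setW]
    · simp [Instr.eval, State.setR, State.setW, h0]

/-- Induction on the expression. Results are kept on a stack of real registers: a second operand is
evaluated at `m + 1`, so it cannot destroy the first one at `m`. The bound on `M` only has to cover
the input addresses and the words used to form them. -/
theorem runs_compile {M : ℕ} (hM : n * (d + 1) + d < M) {a : ℕ} (e : Expr d a) :
    ∀ (m : ℕ) (ρ : Fin a → Fin n) (s : State), 1 ≤ m → Ctx site pr q τ ρ s →
      Runs M (compile e m) s (cost n e)
        (fun s' => Frame a m s s' ∧ s'.rreg m = eval site pr q τ e ρ) := by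
  have hn : n < M := by nlinarith
  have hrec : ∀ (i : Fin n) (c : ℕ), c ≤ d → i * (d + 1) + c < M := fun i c hc => by
    have : (i : ℕ) * (d + 1) ≤ n * (d + 1) := Nat.mul_le_mul_right _ i.2.le
    omega
  induction e with
  | const c =>
    intro m ρ s hm hs
    refine Runs.instr trivial ⟨⟨?_, ?_, ?_⟩, ?_⟩
    · intro i hi; simp [Instr.eval, State.setR]
    · intro i hi; simp [Instr.eval, State.setR, hi.ne]
    · simp [Instr.eval, State.setR]
    · simp [Instr.eval, State.setR, eval]
  | param =>
    intro m ρ s hm hs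
    refine Runs.instr trivial ⟨⟨?_, ?_, ?_⟩, ?_⟩
    · intro i hi; simp [Instr.eval, State.setR]
    · intro i hi; simp [Instr.eval, State.setR, hi.ne]
    · simp [Instr.eval, State.setR]
    · simp [Instr.eval, State.setR, eval, hs.param]
  | coord i c =>
    intro m ρ s hm hs
    refine (runs_read (hrec (ρ i) c c.2.le) (by omega) (hs.var i) hs.stride).mono le_rfl
      fun s' h => ⟨h.1, ?_⟩
    rw [h.2, hs.input.site, eval]
  | prob i =>
    intro m ρ s hm hs
    refine (runs_read (hrec (ρ i) d le_rfl) (by omega) (hs.var i) hs.stride).mono le_rfl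
      fun s' h => ⟨h.1, ?_⟩
    rw [h.2, hs.input.pr, eval]
  | query c =>
    intro m ρ s hm hs
    refine (runs_read (by omega) (by omega) hs.input.size hs.stride).mono le_rfl
      fun s' h => ⟨h.1, ?_⟩
    rw [h.2, hs.input.query, eval]
  | add x y hx hy =>
    intro m ρ s hm hs
    exact runs_binary (hx m ρ s hm hs)
      (fun s' hf => hy (m + 1) ρ s' (by omega) (hs.frame hf hm)) (fun _ => trivial)
      (fun s h h' => by simp [Instr.eval, h, h', eval])
  | sub x y hx hy =>
    intro m ρ s hm hs
    exact runs_binary (hx m ρ s hm hs)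
      (fun s' hf => hy (m + 1) ρ s' (by omega) (hs.frame hf hm)) (fun _ => trivial)
      (fun s h h' => by simp [Instr.eval, h, h', eval])
  | mul x y hx hy =>
    intro m ρ s hm hs
    exact runs_binary (hx m ρ s hm hs)
      (fun s' hf => hy (m + 1) ρ s' (by omega) (hs.frame hf hm)) (fun _ => trivial)
      (fun s h h' => by simp [Instr.eval, h, h', eval])
  | div x y hx hy =>
    intro m ρ s hm hs
    refine (hx m ρ s hm hs).seq fun s₁ ⟨hf, h1⟩ =>
      (hy (m + 1) ρ s₁ (by omega) (hs.frame hf hm)).seq fun s₂ ⟨hf', h2⟩ => ?_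
    have h1' := (hf'.rreg m (by omega)).trans h1
    have hf2 := hf.trans hf' le_rfl (by omega)
    refine Runs.seq (T := 1) (T' := 1 + 1 + 1) (Q' := fun s' => s' = _) (Runs.instr trivial rfl) ?_
    rintro _ rfl
    have hm2 : ∀ i < m, i ≠ m + 2 := fun i hi => by omega
    -- The machine may not divide by zero, so the denominator is tested first; the constant `0` of
    -- the other branch agrees with the convention `x / 0 = 0` in `eval`.
    refine Runs.ite (fun h => Runs.instr trivial ⟨hf2.trans ⟨?_, ?_, ?_⟩ le_rfl le_rfl, ?_⟩)
      (fun h => Runs.instr ?_ ⟨hf2.trans ⟨?_, ?_, ?_⟩ le_rfl le_rfl, ?_⟩)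
    · intro i hi; simp [Instr.eval, State.setR]
    · intro i hi; simp [Instr.eval, State.setR, hi.ne, hm2 i hi]
    · simp [Instr.eval, State.setR]
    · simp [Test.Holds, Instr.eval, State.setR, h2] at h
      simp [Instr.eval, State.setR, eval, h]
    · simpa [Test.Holds, Instr.Ok, Instr.eval, State.setR] using h
    · intro i hi; simp [Instr.eval, State.setR]
    · intro i hi; simp [Instr.eval, State.setR, hi.ne, hm2 i hi]
    · simp [Instr.eval, State.setR]
    · simp [Instr.eval, State.setR, eval, h1', h2]
  | sum x hx =>
    intro m ρ s hm hs
    -- The invariant is the partial sum over the sites with index below `k`.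
    refine Runs.mono (runs_fold (fun k => ∑ i ∈ Finset.univ.filter (fun i : Fin n => (i : ℕ) < k),
      eval site pr q τ x (Fin.snoc ρ i)) hm hn hs (by simp)
      (fun i s hs => hx (m + 1) _ s (by omega) hs) (fun _ => trivial) ?_) le_rfl
      (fun s' h => ⟨h.1, by simpa [eval] using h.2⟩)
    intro i s h h'
    have : Finset.univ.filter (fun j : Fin n => (j : ℕ) < i + 1) =
        insert i (Finset.univ.filter (fun j : Fin n => (j : ℕ) < i)) := by
      ext j; simp [Fin.ext_iff]; omega
    simp only [Instr.eval, h, h', this]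
    rw [Finset.sum_insert (by simp), add_comm]
  | prod x hx =>
    intro m ρ s hm hs
    refine Runs.mono (runs_fold (fun k => ∏ i ∈ Finset.univ.filter (fun i : Fin n => (i : ℕ) < k),
      eval site pr q τ x (Fin.snoc ρ i)) hm hn hs (by simp)
      (fun i s hs => hx (m + 1) _ s (by omega) hs) (fun _ => trivial) ?_) le_rfl
      (fun s' h => ⟨h.1, by simpa [eval] using h.2⟩)
    intro i s h h'
    have : Finset.univ.filter (fun j : Fin n => (j : ℕ) < i + 1) =
        insert i (Finset.univ.filter (fun j : Fin n => (j : ℕ) < i)) := by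
      ext j; simp [Fin.ext_iff]; omega
    simp only [Instr.eval, h, h', this]
    rw [Finset.prod_insert (by simp), mul_comm]
  | @ifPos b c x y hc hx hy =>
    intro m ρ s hm hs
    refine (hc m ρ s hm hs).seq fun s₁ ⟨hf, h1⟩ => ?_
    refine Runs.seq (Q' := fun s' => s' = _) (Runs.instr trivial rfl) ?_
    rintro _ rfl
    have hf2 : Frame b m s (Instr.eval (.rconst (m + 1) 0) s₁) := by
      refine hf.trans ⟨?_, ?_, ?_⟩ le_rfl le_rfl
      · intro i hi; simp [Instr.eval, State.setR]
      · intro i hi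
        have : i ≠ m + 1 := by omega
        simp [Instr.eval, State.setR, this]
      · simp [Instr.eval, State.setR]
    have hs2 := hs.frame hf2 hm
    refine Runs.ite (fun h => (hx m ρ _ hm hs2).mono le_rfl fun s' h' => ?_)
      (fun h => (hy m ρ _ hm hs2).mono le_rfl fun s' h' => ?_)
    · simp [Test.Holds, Instr.eval, State.setR, h1] at h
      exact ⟨hf2.trans h'.1 le_rfl le_rfl, by rw [h'.2, eval, if_pos h]⟩
    · simp only [Test.Holds, Instr.eval, State.setR, Function.update_self, Rat.cast_zero,
        ne_eq, Nat.left_eq_add, one_ne_zero, not_false_eq_true, Function.update_of_ne, h1] at h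
      exact ⟨hf2.trans h'.1 le_rfl le_rfl, by rw [h'.2, eval, if_neg h]⟩
  | ifLt i j x y hx hy =>
    intro m ρ s hm hs
    refine Runs.ite (fun h => (hx m ρ _ hm hs).mono le_rfl fun s' h' => ?_)
      (fun h => (hy m ρ _ hm hs).mono le_rfl fun s' h' => ?_)
    all_goals
      simp only [Test.Holds, hs.var, Fin.val_fin_lt] at h
      exact ⟨h'.1, by simp [h'.2, eval, h]⟩
  | ifEq i j x y hx hy =>
    intro m ρ s hm hs
    refine Runs.ite (fun h => (hx m ρ _ hm hs).mono le_rfl fun s' h' => ?_)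
      (fun h => (hy m ρ _ hm hs).mono le_rfl fun s' h' => ?_)
    all_goals
      simp only [Test.Holds, hs.var, Fin.val_inj] at h
      exact ⟨h'.1, by simp [h'.2, eval, h]⟩
  | ifOne x y hx hy =>
    intro m ρ s hm hs
    refine Runs.ite (fun h => (hx m ρ _ hm hs).mono le_rfl fun s' h' => ?_)
      (fun h => (hy m ρ _ hm hs).mono le_rfl fun s' h' => ?_)
    all_goals
      simp only [Test.Holds, hs.input.size, hs.one] at h
      exact ⟨h'.1, by simp [h'.2, eval, h]⟩

end Expr

end RealRAM

/-! ### Facets of a cone cut by a two-dimensional plane -/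

namespace Unipoint

open Matrix

variable {ι : Type*}

/-- Any `k` or fewer distinct members of the family `w` of vectors of `ℝ^k` are linearly
independent. -/
def LinearGeneralPosition {k : ℕ} (w : ι → Fin k → ℝ) : Prop :=
  ∀ m ≤ k, ∀ f : Fin m → ι, f.Injective → LinearIndependent ℝ (w ∘ f)

/-- Forgetting the first two coordinates. -/
def dropTwo {p : ℕ} (w : ι → Fin (p + 2) → ℝ) (i : ι) (c : Fin p) : ℝ := w i c.succ.succ

/-- The coefficients, given by minors, of a linear dependence between `p + 1` vectors of `ℝ^p`. -/
noncomputable def minorCoeff {p : ℕ} (x : ι → Fin p → ℝ) (f : Fin (p + 1) → ι) (j : Fin (p + 1)) :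
    ℝ :=
  (-1) ^ (j : ℕ) * det (of fun a => x (f (j.succAbove a)))

/-- Laplace expansion along an added zeroth column holding the values of `h`. -/
theorem sum_minorCoeff_mul {p : ℕ} (x : ι → Fin p → ℝ) (f : Fin (p + 1) → ι) (h : ι → ℝ) :
    ∑ j, minorCoeff x f j * h (f j) =
      det (of fun j => (Fin.cons (h (f j)) (x (f j)) : Fin (p + 1) → ℝ)) := by
  rw [det_succ_column_zero]
  refine Finset.sum_congr rfl fun j _ => ?_
  simp only [minorCoeff, of_apply, Fin.cons_zero, mul_right_comm]
  congr 2

/-- Taking a coordinate for `h` repeats a column of the determinant. -/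
theorem sum_minorCoeff_smul {p : ℕ} (x : ι → Fin p → ℝ) (f : Fin (p + 1) → ι) :
    ∑ j, minorCoeff x f j • x (f j) = 0 := by
  ext c
  simp only [Finset.sum_apply, Pi.smul_apply, smul_eq_mul, Pi.zero_apply]
  rw [sum_minorCoeff_mul x f (fun i => x i c)]
  exact det_zero_of_column_eq (Fin.succ_ne_zero c).symm (fun j => by simp)

/-- The coefficients of `minorCoeff`, scaled so that the first one is nonnegative. -/
noncomputable def coneCoeff {p : ℕ} (x : ι → Fin p → ℝ) (f : Fin (p + 1) → ι) (j : Fin (p + 1)) :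
    ℝ :=
  minorCoeff x f 0 * minorCoeff x f j

/-- A linear functional that vanishes on the vectors `w (f j)`. -/
noncomputable def sideFunctional {p : ℕ} (w : ι → Fin (p + 2) → ℝ) (f : Fin (p + 1) → ι) :
    (Fin (p + 2) → ℝ) →ₗ[ℝ] ℝ :=
  minorCoeff (dropTwo w) f 0 • (detRowAlternating (R := ℝ)).toMultilinearMap.toLinearMap
    (Fin.cons (0 : Fin (p + 2) → ℝ) (fun j => w (f j)) : Fin (p + 2) → Fin (p + 2) → ℝ) 0

theorem sideFunctional_apply {p : ℕ} (w : ι → Fin (p + 2) → ℝ) (f : Fin (p + 1) → ι)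
    (v : Fin (p + 2) → ℝ) :
    sideFunctional w f v = minorCoeff (dropTwo w) f 0 *
      det (of (Fin.cons v (fun j => w (f j)) : Fin (p + 2) → Fin (p + 2) → ℝ)) := by
  simp only [sideFunctional, LinearMap.smul_apply, smul_eq_mul]
  congr 1
  simp only [MultilinearMap.toLinearMap_apply, Fin.update_cons_zero]
  rfl

theorem sideFunctional_self {p : ℕ} (w : ι → Fin (p + 2) → ℝ) (f : Fin (p + 1) → ι)
    (j : Fin (p + 1)) : sideFunctional w f (w (f j)) = 0 := by
  rw [sideFunctional_apply, det_zero_of_row_eq (Fin.succ_ne_zero j).symm, mul_zero]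
  ext c
  simp

/-- The intersection of the cone of the vectors `w (f j)` with the plane of the first two
coordinates. -/
noncomputable def planeRay {p : ℕ} (w : ι → Fin (p + 2) → ℝ) (f : Fin (p + 1) → ι) :
    Fin (p + 2) → ℝ :=
  ∑ j, coneCoeff (dropTwo w) f j • w (f j)

theorem planeRay_succ_succ {p : ℕ} (w : ι → Fin (p + 2) → ℝ) (f : Fin (p + 1) → ι) (c : Fin p) :
    planeRay w f c.succ.succ = 0 := by
  have h := congr_fun (sum_minorCoeff_smul (dropTwo w) f) c
  simp only [Finset.sum_apply, Pi.smul_apply, smul_eq_mul, Pi.zero_apply, dropTwo] at h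
  simp only [planeRay, coneCoeff, Finset.sum_apply, Pi.smul_apply, smul_eq_mul, mul_assoc,
    ← Finset.mul_sum]
  rw [show ∑ i, minorCoeff (dropTwo w) f i * w (f i) c.succ.succ = 0 from h, mul_zero]

/-- Expanding along the row `v`, only two entries survive, and their minors are the two coordinates
of `planeRay` by `sum_minorCoeff_mul`. On the plane the functional is thus the cross product with
the ray, and the question of sides becomes one of angles. -/
theorem sideFunctional_of_plane {p : ℕ} (w : ι → Fin (p + 2) → ℝ) (f : Fin (p + 1) → ι)
    (v : Fin (p + 2) → ℝ) (hv : ∀ c : Fin p, v c.succ.succ = 0) :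
    sideFunctional w f v = v 0 * planeRay w f 1 - v 1 * planeRay w f 0 := by
  have h0 := sum_minorCoeff_mul (dropTwo w) f (fun i => w i 0)
  have h1 := sum_minorCoeff_mul (dropTwo w) f (fun i => w i 1)
  simp only [planeRay, coneCoeff, Finset.sum_apply, Pi.smul_apply, smul_eq_mul, mul_assoc,
    ← Finset.mul_sum]
  rw [h0, h1, sideFunctional_apply, det_succ_row_zero, Fin.sum_univ_succ, Fin.sum_univ_succ]
  simp only [of_apply, Fin.cons_zero, hv, mul_zero, zero_mul, Finset.sum_const_zero, add_zero]
  have e0 : (of (Fin.cons v (fun j => w (f j)) : Fin (p + 2) → Fin (p + 2) → ℝ)).submatrix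
      Fin.succ (Fin.succAbove 0) =
      of fun j => (Fin.cons (w (f j) 1) (dropTwo w (f j)) : Fin (p + 1) → ℝ) := by
    ext j c
    refine Fin.cases ?_ (fun c => ?_) c <;> simp [dropTwo]
  have e1 : (of (Fin.cons v (fun j => w (f j)) : Fin (p + 2) → Fin (p + 2) → ℝ)).submatrix
      Fin.succ (Fin.succAbove (Fin.succ 0)) =
      of fun j => (Fin.cons (w (f j) 0) (dropTwo w (f j)) : Fin (p + 1) → ℝ) := by
    ext j c
    refine Fin.cases ?_ (fun c => ?_) c <;> simp [dropTwo]
  rw [e0, e1]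
  simp
  ring

/-! ### Positive circuits of vectors in general position -/

section GeneralPosition

variable {p : ℕ}

theorem minorCoeff_ne_zero {x : ι → Fin p → ℝ} (hx : LinearGeneralPosition x)
    {f : Fin (p + 1) → ι} (hf : f.Injective) (j : Fin (p + 1)) : minorCoeff x f j ≠ 0 := by
  have h := hx p le_rfl (f ∘ j.succAbove) (hf.comp Fin.succAbove_right_injective)
  have h' : IsUnit (of fun a => x (f (j.succAbove a)) : Matrix (Fin p) (Fin p) ℝ) :=
    linearIndependent_rows_iff_isUnit.1 h
  exact mul_ne_zero (pow_ne_zero _ (by norm_num)) ((isUnit_iff_isUnit_det _).1 h').ne_zero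

theorem sideFunctional_ne_zero {w : ι → Fin (p + 2) → ℝ} (hw : LinearGeneralPosition w)
    (hx : LinearGeneralPosition (dropTwo w)) {f : Fin (p + 1) → ι} (hf : f.Injective) {b : ι}
    (hb : ∀ j, f j ≠ b) : sideFunctional w f (w b) ≠ 0 := by
  have hinj : (Fin.cons b f : Fin (p + 2) → ι).Injective :=
    Fin.cons_injective_iff.2 ⟨fun ⟨j, hj⟩ => hb j hj, hf⟩
  have h := hw (p + 2) le_rfl _ hinj
  have h' : IsUnit (of (w ∘ (Fin.cons b f : Fin (p + 2) → ι)) : Matrix (Fin (p + 2)) _ ℝ) :=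
    linearIndependent_rows_iff_isUnit.1 h
  have e : (of (Fin.cons (w b) (fun j => w (f j)) : Fin (p + 2) → Fin (p + 2) → ℝ)) =
      of (w ∘ (Fin.cons b f : Fin (p + 2) → ι)) := by
    ext j c
    refine Fin.cases ?_ (fun j => ?_) j <;> simp
  rw [sideFunctional_apply, e]
  exact mul_ne_zero (minorCoeff_ne_zero hx hf 0) ((isUnit_iff_isUnit_det _).1 h').ne_zero

/-- A dependence between `p + 1` vectors of `ℝ^p` in general position is unique up to scaling. -/
theorem exists_coneCoeff_eq {x : ι → Fin p → ℝ} (hx : LinearGeneralPosition x)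
    {f : Fin (p + 1) → ι} (hf : f.Injective) {μ : Fin (p + 1) → ℝ} (hμ : ∀ j, 0 < μ j)
    (h : ∑ j, μ j • x (f j) = 0) : ∃ τ : ℝ, 0 < τ ∧ ∀ j, coneCoeff x f j = τ * μ j := by
  have h0 := minorCoeff_ne_zero hx hf 0
  -- Combine the two dependences so that the coefficient of `f 0` cancels; the remaining `p` vectors
  -- are independent.
  have hsum : ∑ j : Fin p, (minorCoeff x f 0 * μ j.succ - μ 0 * minorCoeff x f j.succ) •
      (x ∘ (f ∘ Fin.succ)) j = 0 := by
    have h1 : ∑ j, (minorCoeff x f 0 * μ j - μ 0 * minorCoeff x f j) • x (f j) = 0 := by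
      simp only [sub_smul, mul_smul, Finset.sum_sub_distrib, ← Finset.smul_sum, h,
        sum_minorCoeff_smul, smul_zero, sub_zero]
    rw [Fin.sum_univ_succ, mul_comm (μ 0), sub_self, zero_smul, zero_add] at h1
    exact h1
  have hli := Fintype.linearIndependent_iff.1
    (hx p le_rfl (f ∘ Fin.succ) (hf.comp (Fin.succ_injective p))) _ hsum
  have hμ0 := hμ 0
  refine ⟨minorCoeff x f 0 ^ 2 / μ 0, by positivity, fun j => ?_⟩
  refine Fin.cases ?_ (fun j => ?_) j
  · rw [coneCoeff]; field_simp
  · have := hli j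
    rw [coneCoeff]; field_simp; linear_combination -this

/-- Facets are counted once, as increasing tuples, so circuits have to be sorted. Uniqueness of the
dependence makes positivity of `coneCoeff` survive the sorting. The last clause transfers the
combination to vectors of any dimension, in particular to the vectors before projection. -/
theorem exists_strictMono [LinearOrder ι] {x : ι → Fin p → ℝ} (hx : LinearGeneralPosition x)
    {f : Fin (p + 1) → ι} (hf : f.Injective) {μ : Fin (p + 1) → ℝ} (hμ : ∀ j, 0 < μ j)
    (h : ∑ j, μ j • x (f j) = 0) :
    ∃ g : Fin (p + 1) → ι, StrictMono g ∧ (∀ j, ∃ j', g j = f j') ∧ (∀ j, 0 < coneCoeff x g j) ∧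
      ∃ τ : ℝ, 0 < τ ∧ ∀ {k : ℕ} (w : ι → Fin k → ℝ),
        ∑ j, coneCoeff x g j • w (g j) = τ • ∑ j, μ j • w (f j) := by
  set σ := Tuple.sort f
  have hg : StrictMono (f ∘ σ) :=
    (Tuple.monotone_sort f).strictMono_of_injective (hf.comp σ.injective)
  obtain ⟨τ, hτ, hτ'⟩ := exists_coneCoeff_eq hx hg.injective (μ := μ ∘ σ) (fun j => hμ _) (by
    rw [← h]; exact Equiv.sum_comp σ (fun j => μ j • x (f j)))
  refine ⟨f ∘ σ, hg, fun j => ⟨σ j, rfl⟩, fun j => ?_, τ, hτ, fun w => ?_⟩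
  · rw [hτ']; exact mul_pos hτ (hμ _)
  · simp only [hτ', mul_smul, ← Finset.smul_sum]
    congr 1
    exact Equiv.sum_comp σ (fun j => μ j • w (f j))

/-- Carathéodory gives positive weights on at most `p + 1` vectors; with fewer, they would be
linearly dependent against general position. -/
theorem exists_positive_circuit {x : ι → Fin p → ℝ} (hx : LinearGeneralPosition x) {B : Set ι}
    (h0 : (0 : Fin p → ℝ) ∈ convexHull ℝ (x '' B)) :
    ∃ (f : Fin (p + 1) → ι) (μ : Fin (p + 1) → ℝ), f.Injective ∧ (∀ j, f j ∈ B) ∧ (∀ j, 0 < μ j) ∧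
      ∑ j, μ j • x (f j) = 0 := by
  obtain ⟨κ, _, z, ν, hz, haff, hν, hν1, hsum⟩ := eq_pos_convex_span_of_mem_convexHull h0
  have hcard := haff.card_le_finrank_succ
  have hle : Module.finrank ℝ (vectorSpan ℝ (Set.range z)) ≤ p := by
    simpa using Submodule.finrank_le (vectorSpan ℝ (Set.range z))
  choose b hbB hb using fun i => hz ⟨i, rfl⟩
  have hbinj : b.Injective := fun i j hij => haff.injective (by rw [← hb, ← hb, hij])
  have hcard' : Fintype.card κ = p + 1 := by
    by_contra hne
    have e := Fintype.equivFin κ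
    have hli := Fintype.linearIndependent_iff.1
      (hx (Fintype.card κ) (by omega) (b ∘ e.symm) (hbinj.comp e.symm.injective)) (ν ∘ e.symm) (by
        rw [← hsum]
        simp only [Function.comp_apply, hb]
        exact Equiv.sum_comp e.symm (fun i => ν i • z i))
    have hz : ∀ i, ν i = 0 := fun i => by simpa using hli (e i)
    simp [hz] at hν1
  have e : Fin (p + 1) ≃ κ := (Fintype.equivFinOfCardEq hcard').symm
  refine ⟨b ∘ e, ν ∘ e, hbinj.comp e.injective, fun j => hbB _, fun j => hν _, ?_⟩
  rw [← hsum]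
  simp only [Function.comp_apply, hb]
  exact Equiv.sum_comp e (fun i => ν i • z i)

/-- Exchange step: if `f` is a positive circuit of vectors of `ℝ^p`, then a further index `b`
belongs to a positive circuit inside `f` and `b`. -/
theorem exists_exchange [DecidableEq ι] {x : ι → Fin p → ℝ} (hx : LinearGeneralPosition x)
    {f : Fin (p + 1) → ι} (hf : f.Injective) {μ : Fin (p + 1) → ℝ} (hμ : ∀ j, 0 < μ j)
    (h : ∑ j, μ j • x (f j) = 0) {b : ι} (hb : ∀ j, f j ≠ b) :
    ∃ (j₀ : Fin (p + 1)) (ν : Fin (p + 1) → ℝ), (Function.update f j₀ b).Injective ∧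
      (∀ j, 0 < ν j) ∧ ν j₀ = 1 ∧ ∑ j, ν j • x (Function.update f j₀ b j) = 0 := by
  have hli := hx p le_rfl (f ∘ Fin.succ) (hf.comp (Fin.succ_injective p))
  have hspan : -x b ∈ Submodule.span ℝ (Set.range (x ∘ (f ∘ Fin.succ))) := by
    rw [hli.span_eq_top_of_card_eq_finrank' (by simp)]; trivial
  obtain ⟨e, he⟩ := (Submodule.mem_span_range_iff_exists_fun ℝ).1 hspan
  set e' : Fin (p + 1) → ℝ := Fin.cons 0 e with he'
  have hsum : ∑ j, e' j • x (f j) = -x b := by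
    rw [Fin.sum_univ_succ]; simpa [he'] using he
  -- As in a pivot of the simplex method, add the least multiple `s` of the circuit that makes all
  -- coefficients of `-x b` nonnegative. The coefficient at `j₀` becomes zero, so `b` takes its
  -- place.
  obtain ⟨j₀, hj₀⟩ := Finite.exists_max (fun j => -e' j / μ j)
  set s := -e' j₀ / μ j₀ with hs
  set c : Fin (p + 1) → ℝ := fun j => e' j + s * μ j with hc
  have hc0 : ∀ j, 0 ≤ c j := fun j => by
    have : -e' j / μ j ≤ s := hj₀ j
    rw [div_le_iff₀ (hμ j)] at this
    simp only [hc]; linarith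
  have hcj₀ : c j₀ = 0 := by
    have := (hμ j₀).ne'
    simp only [hc, hs]; field_simp; ring
  have hcsum : ∑ j, c j • x (f j) = -x b := by
    simp only [hc, add_smul, mul_smul, Finset.sum_add_distrib, ← Finset.smul_sum, h, hsum,
      smul_zero, add_zero]
  have hinj : (Function.update f j₀ b).Injective := by
    intro i j hij
    by_cases hi : i = j₀ <;> by_cases hj : j = j₀
    · rw [hi, hj]
    · subst hi; simp [hj] at hij; exact absurd hij.symm (hb j)
    · subst hj; simp [hi] at hij; exact absurd hij (hb i)
    · simp [hi, hj] at hij; exact hf hij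
  have hνsum : ∑ j, Function.update c j₀ 1 j • x (Function.update f j₀ b j) = 0 := by
    have h1 : ∀ j, Function.update c j₀ 1 j • x (Function.update f j₀ b j) =
        c j • x (f j) + if j = j₀ then x b else 0 := fun j => by
      by_cases hj : j = j₀
      · subst hj; simp [hcj₀]
      · simp [hj]
    simp only [h1, Finset.sum_add_distrib, hcsum]
    simp
  refine ⟨j₀, Function.update c j₀ 1, hinj, fun j₁ => ?_, by simp, hνsum⟩
  by_cases hj₁ : j₁ = j₀
  · subst hj₁; simp
  · rw [Function.update_of_ne hj₁]
    -- A second vanishing coefficient would leave a dependence among `p` vectors, with coefficient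
    -- `1` at `b`.
    refine lt_of_le_of_ne (hc0 j₁) fun hzero => ?_
    rw [Fin.sum_univ_succAbove _ j₁, Function.update_of_ne hj₁, ← hzero, zero_smul, zero_add]
      at hνsum
    have hli' := Fintype.linearIndependent_iff.1 (hx p le_rfl (Function.update f j₀ b ∘ j₁.succAbove)
      (hinj.comp Fin.succAbove_right_injective)) _ hνsum
    obtain ⟨i, hi⟩ := Fin.exists_succAbove_eq (Ne.symm hj₁)
    have := hli' i
    simp [hi] at this

end GeneralPosition

theorem mem_convexHull_image_iff {ι E : Type*} [AddCommGroup E] [Module ℝ E] {w : ι → E}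
    {B : Finset ι} {y : E} :
    y ∈ convexHull ℝ (w '' B) ↔
      ∃ μ : ι → ℝ, (∀ i ∈ B, 0 ≤ μ i) ∧ ∑ i ∈ B, μ i = 1 ∧ ∑ i ∈ B, μ i • w i = y := by
  classical
  constructor
  · intro h
    refine convexHull_min (t := {y | ∃ μ : ι → ℝ, (∀ i ∈ B, 0 ≤ μ i) ∧ ∑ i ∈ B, μ i = 1 ∧
      ∑ i ∈ B, μ i • w i = y}) ?_ ?_ h
    · rintro _ ⟨i, hi, rfl⟩
      have hi' : i ∈ B := hi
      refine ⟨fun j => if j = i then 1 else 0, fun j _ => ?_, by simp [hi'], by simp [hi']⟩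
      dsimp only
      split_ifs <;> norm_num
    · rintro _ ⟨μ, hμ, hμ1, rfl⟩ _ ⟨ν, hν, hν1, rfl⟩ a b ha hb hab
      refine ⟨fun i => a * μ i + b * ν i, fun i hi => ?_, ?_, ?_⟩
      · have := hμ i hi
        have := hν i hi
        positivity
      · rw [Finset.sum_add_distrib, ← Finset.mul_sum, ← Finset.mul_sum, hμ1, hν1, mul_one, mul_one,
          hab]
      · simp only [add_smul, mul_smul, Finset.sum_add_distrib, ← Finset.smul_sum]
  · rintro ⟨μ, hμ, hμ1, rfl⟩
    exact (convex_convexHull ℝ _).sum_mem hμ hμ1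
      (fun i hi => subset_convexHull ℝ _ ⟨i, hi, rfl⟩)

/-- The vectors `w (f j)` span the extreme facet, in a fixed sense of rotation, of the cone of `B`
among those that meet the plane of the first two coordinates. -/
structure IsExtremeFacet {p : ℕ} [Preorder ι] (w : ι → Fin (p + 2) → ℝ) (B : Set ι)
    (f : Fin (p + 1) → ι) : Prop where
  strictMono : StrictMono f
  coeff_pos : ∀ j, 0 < coneCoeff (dropTwo w) f j
  mem : ∀ j, f j ∈ B
  side_pos : ∀ b ∈ B, (∀ j, f j ≠ b) → 0 < sideFunctional w f (w b)

/-! ### Existence and uniqueness of the extreme facet -/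

section Facets

variable {p : ℕ} [LinearOrder ι] {w : ι → Fin (p + 2) → ℝ} {B : Set ι} {f g : Fin (p + 1) → ι}

theorem IsExtremeFacet.side_nonneg (hf : IsExtremeFacet w B f) {b : ι} (hb : b ∈ B) :
    0 ≤ sideFunctional w f (w b) := by
  by_cases h : ∀ j, f j ≠ b
  · exact (hf.side_pos b hb h).le
  · push Not at h
    obtain ⟨j, rfl⟩ := h
    rw [sideFunctional_self]

theorem IsExtremeFacet.side_planeRay_pos (hf : IsExtremeFacet w B f) (hg : IsExtremeFacet w B g)
    (h : ∃ i, ∀ j, f j ≠ g i) : 0 < sideFunctional w f (planeRay w g) := by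
  obtain ⟨i, hi⟩ := h
  simp only [planeRay, map_sum, map_smul, smul_eq_mul]
  exact Finset.sum_pos' (fun j _ => mul_nonneg (hg.coeff_pos j).le (hf.side_nonneg (hg.mem j)))
    ⟨i, Finset.mem_univ _, mul_pos (hg.coeff_pos i) (hf.side_pos _ (hg.mem i) hi)⟩

/-- For two different facets, each ray would lie strictly on the positive side of the other, but the
cross product is antisymmetric. -/
theorem IsExtremeFacet.unique (hf : IsExtremeFacet w B f) (hg : IsExtremeFacet w B g) : f = g := by
  have key : ∀ {f g : Fin (p + 1) → ι}, f.Injective → g.Injective → Set.range f ≠ Set.range g →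
      ∃ i, ∀ j, f j ≠ g i := by
    intro f g hf hg hne
    by_contra! hcon
    refine hne (Set.eq_of_subset_of_ncard_le (s := Set.range g) (t := Set.range f) ?_ ?_
      (Set.finite_range f)).symm
    · rintro _ ⟨i, rfl⟩
      obtain ⟨j, hj⟩ := hcon i
      exact ⟨j, hj⟩
    · rw [← Set.image_univ, ← Set.image_univ, Set.ncard_image_of_injective _ hf,
        Set.ncard_image_of_injective _ hg]
  by_contra hne
  have hr : Set.range f ≠ Set.range g := fun h =>
    hne ((hf.strictMono.range_inj hg.strictMono).1 h)
  have h1 := hf.side_planeRay_pos hg (key hf.strictMono.injective hg.strictMono.injective hr)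
  have h2 := hg.side_planeRay_pos hf (key hg.strictMono.injective hf.strictMono.injective hr.symm)
  rw [sideFunctional_of_plane _ _ _ (planeRay_succ_succ w _)] at h1 h2
  linarith

/-- The functional is nonnegative on `B` and zero only on the facet, so a convex combination equal
to `0` is supported on the facet, whose `p + 1` vectors are independent. -/
theorem IsExtremeFacet.zero_notMem (hw : LinearGeneralPosition w) {B : Finset ι}
    (hf : IsExtremeFacet w (B : Set ι) f) : (0 : Fin (p + 2) → ℝ) ∉ convexHull ℝ (w '' B) := by
  classical
  rw [mem_convexHull_image_iff]
  rintro ⟨μ, hμ0, hμ1, hμ⟩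
  have h1 : ∑ i ∈ B, μ i * sideFunctional w f (w i) = 0 := by
    have := congr_arg (sideFunctional w f) hμ
    simpa only [map_sum, map_smul, smul_eq_mul, map_zero] using this
  rw [Finset.sum_eq_zero_iff_of_nonneg
    (fun i hi => mul_nonneg (hμ0 i hi) (hf.side_nonneg hi))] at h1
  have h2 : ∀ i ∈ B, i ∉ Finset.univ.image f → μ i = 0 := fun i hi hi' => by
    have := hf.side_pos i hi (by simpa using hi')
    simpa [this.ne'] using h1 i hi
  have hsub : Finset.univ.image f ⊆ B := by
    intro i hi
    obtain ⟨j, -, rfl⟩ := Finset.mem_image.1 hi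
    exact hf.mem j
  have hinj := hf.strictMono.injective
  rw [← Finset.sum_subset hsub (fun i hi hi' => by rw [h2 i hi hi', zero_smul]),
    Finset.sum_image hinj.injOn] at hμ
  rw [← Finset.sum_subset hsub h2, Finset.sum_image hinj.injOn] at hμ1
  have h3 := Fintype.linearIndependent_iff.1 (hw (p + 1) (by omega) f hinj) _ hμ
  simp [h3] at hμ1

theorem IsExtremeFacet.zero_mem_dropTwo (hf : IsExtremeFacet w B f) :
    (0 : Fin p → ℝ) ∈ convexHull ℝ (dropTwo w '' B) := by
  have hpos : 0 < ∑ j, coneCoeff (dropTwo w) f j :=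
    Finset.sum_pos (fun j _ => hf.coeff_pos j) Finset.univ_nonempty
  have h := Finset.univ.centerMass_mem_convexHull (R := ℝ) (s := dropTwo w '' B)
    (fun j _ => (hf.coeff_pos j).le) hpos
    (z := fun j => dropTwo w (f j)) (fun j _ => ⟨f j, hf.mem j, rfl⟩)
  have h0 : ∑ j, coneCoeff (dropTwo w) f j • dropTwo w (f j) = 0 := by
    simp only [coneCoeff, mul_smul, ← Finset.smul_sum, sum_minorCoeff_smul, smul_zero]
  rwa [Finset.centerMass, h0, smul_zero] at h

/-- A separating functional `ℓ` puts all candidate rays in an open half-plane, where they can be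
ordered by angle; take the last one. If some `b` were on the wrong side of its facet, exchanging `b`
into the circuit would give a ray beyond it. -/
theorem exists_isExtremeFacet [Finite ι] (hw : LinearGeneralPosition w)
    (hx : LinearGeneralPosition (dropTwo w))
    (h0 : (0 : Fin p → ℝ) ∈ convexHull ℝ (dropTwo w '' B))
    (h : (0 : Fin (p + 2) → ℝ) ∉ convexHull ℝ (w '' B)) : ∃ f, IsExtremeFacet w B f := by
  classical
  obtain ⟨ℓ, u, hu, hℓ⟩ := geometric_hahn_banach_point_closed (convex_convexHull ℝ _)
    (Set.Finite.isClosed_convexHull (𝕜 := ℝ) (Set.toFinite (w '' B))) h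
  have hpos : ∀ b ∈ B, 0 < ℓ (w b) := fun b hb => by
    have := hℓ _ (subset_convexHull ℝ _ ⟨b, hb, rfl⟩)
    rw [map_zero] at hu
    linarith
  set 𝒞 : Set (Fin (p + 1) → ι) :=
    {f | StrictMono f ∧ (∀ j, f j ∈ B) ∧ ∀ j, 0 < coneCoeff (dropTwo w) f j} with h𝒞
  have hne : 𝒞.Nonempty := by
    obtain ⟨f, μ, hf, hfB, hμ, hsum⟩ := exists_positive_circuit hx h0
    obtain ⟨g, hg, hgf, hgc, -⟩ := exists_strictMono hx hf hμ hsum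
    refine ⟨g, hg, fun j => ?_, hgc⟩
    obtain ⟨j', hj'⟩ := hgf j
    rw [hj']; exact hfB j'
  set u₀ := ℓ (Pi.single 0 1)
  set u₁ := ℓ (Pi.single 1 1)
  have hplane : ∀ f : Fin (p + 1) → ι,
      ℓ (planeRay w f) = planeRay w f 0 * u₀ + planeRay w f 1 * u₁ := by
    intro f
    have : planeRay w f = planeRay w f 0 • Pi.single 0 1 + planeRay w f 1 • Pi.single 1 1 := by
      ext c
      refine Fin.cases ?_ (fun c => Fin.cases ?_ (fun c => ?_) c) c
      · simp
      · simp
      · have h1 : (c.succ.succ : Fin (p + 2)) ≠ 1 := by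
          rw [Ne, Fin.ext_iff]; simp
        simp [planeRay_succ_succ, h1]
    conv_lhs => rw [this]
    simp only [map_add, map_smul, smul_eq_mul, u₀, u₁]
  have hray : ∀ f ∈ 𝒞, 0 < planeRay w f 0 * u₀ + planeRay w f 1 * u₁ := by
    rintro f ⟨-, hfB, hfc⟩
    rw [← hplane, planeRay, map_sum]
    simp only [map_smul, smul_eq_mul]
    exact Finset.sum_pos (fun j _ => mul_pos (hfc j) (hpos _ (hfB j))) Finset.univ_nonempty
  -- The quotient is the tangent of the angle from `(u₀, u₁)` to the ray; its denominator is
  -- positive by `hray`.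
  obtain ⟨f, hf, hmax⟩ := Set.exists_max_image 𝒞
    (fun f => (planeRay w f 1 * u₀ - planeRay w f 0 * u₁) /
      (planeRay w f 0 * u₀ + planeRay w f 1 * u₁)) (Set.toFinite 𝒞) hne
  have hside : ∀ g ∈ 𝒞, 0 ≤ sideFunctional w f (planeRay w g) := by
    intro g hg
    rw [sideFunctional_of_plane _ _ _ (planeRay_succ_succ w g)]
    have h1 := hmax g hg
    have hfp := hray f hf
    have hgp := hray g hg
    rw [div_le_div_iff₀ hgp hfp] at h1
    have hu : 0 < u₀ ^ 2 + u₁ ^ 2 := by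
      by_contra hcon
      have h0 : u₀ = 0 := by nlinarith [sq_nonneg u₀, sq_nonneg u₁]
      have h1 : u₁ = 0 := by nlinarith [sq_nonneg u₀, sq_nonneg u₁]
      simp [h0, h1] at hfp
    by_contra! hneg
    -- The difference of the two sides of `h1` is `u₀ ^ 2 + u₁ ^ 2` times the cross product.
    nlinarith [mul_neg_of_pos_of_neg hu hneg]
  obtain ⟨hfm, hfB, hfc⟩ := hf
  refine ⟨f, hfm, hfc, hfB, fun b hb hbf => ?_⟩
  by_contra hcon
  have hlt : sideFunctional w f (w b) < 0 :=
    lt_of_le_of_ne (not_lt.1 hcon) (sideFunctional_ne_zero hw hx hfm.injective hbf)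
  have hsum : ∑ j, coneCoeff (dropTwo w) f j • dropTwo w (f j) = 0 := by
    simp only [coneCoeff, mul_smul, ← Finset.smul_sum, sum_minorCoeff_smul, smul_zero]
  obtain ⟨j₀, ν, hinj, hν, hν₀, hνsum⟩ := exists_exchange hx hfm.injective hfc hsum hbf
  obtain ⟨g, hg, hgf, hgc, τ, hτ, hτ'⟩ := exists_strictMono hx hinj hν hνsum
  have hg𝒞 : g ∈ 𝒞 := by
    refine ⟨hg, fun j => ?_, hgc⟩
    obtain ⟨j', hj'⟩ := hgf j
    rw [hj']
    by_cases h : j' = j₀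
    · subst h; simpa using hb
    · rw [Function.update_of_ne h]; exact hfB _
  have h2 := hside g hg𝒞
  rw [planeRay, hτ' w, map_smul, map_sum, smul_eq_mul] at h2
  -- The functional of `f` vanishes on the vectors kept from `f`, so only `b` contributes, with
  -- weight `1`.
  have h3 : ∑ j, sideFunctional w f (ν j • w (Function.update f j₀ b j)) =
      sideFunctional w f (w b) := by
    rw [Finset.sum_eq_single j₀]
    · simp [hν₀]
    · intro j _ hj
      rw [Function.update_of_ne hj, map_smul, sideFunctional_self, smul_zero]
    · simp
  rw [h3] at h2
  nlinarith [mul_neg_of_pos_of_neg hτ hlt]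

end Facets

end Unipoint

/-! ### Probabilities -/

namespace Unipoint

section Probability

variable {n : ℕ}

/-- Independence, as the expansion of a product of binomials: an event that constrains each site
separately has a product probability. -/
theorem sum_outcomeProb_mul_ite (pr : Fin n → ℝ) (a b : Fin n → Prop) [DecidablePred a]
    [DecidablePred b] :
    ∑ B, outcomeProb pr B * (if (∀ i ∈ B, a i) ∧ ∀ i ∈ Bᶜ, b i then 1 else 0) =
      ∏ i, ((if a i then pr i else 0) + if b i then 1 - pr i else 0) := by
  rw [Finset.prod_add, Finset.powerset_univ]
  refine Finset.sum_congr rfl fun B _ => ?_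
  rw [Finset.prod_ite_zero, ← Finset.compl_eq_univ_sdiff, Finset.prod_ite_zero, outcomeProb]
  by_cases h1 : ∀ i ∈ B, a i <;> by_cases h2 : ∀ i ∈ Bᶜ, b i
  · rw [if_pos ⟨h1, h2⟩, if_pos h1, if_pos h2, mul_one]
  · rw [if_neg (fun h => h2 h.2), if_neg h2, mul_zero, mul_zero]
  · rw [if_neg (fun h => h1 h.1), if_neg h1, mul_zero, zero_mul]
  · rw [if_neg (fun h => h1 h.1), if_neg h1, mul_zero, zero_mul]

theorem sum_outcomeProb (pr : Fin n → ℝ) : ∑ B, outcomeProb pr B = 1 := by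
  simpa using sum_outcomeProb_mul_ite pr (fun _ => True) (fun _ => True)

open Classical in
/-- Probability that the origin is not in the convex hull of the existing vectors. -/
noncomputable def avoidProb {k : ℕ} (w : Fin n → Fin k → ℝ) (pr : Fin n → ℝ) : ℝ :=
  ∑ B : Finset (Fin n), outcomeProb pr B *
    if (0 : Fin k → ℝ) ∈ convexHull ℝ (w '' (B : Set (Fin n))) then 0 else 1

theorem avoidProb_zero (w : Fin n → Fin 0 → ℝ) (pr : Fin n → ℝ) :
    avoidProb w pr = ∏ i, (1 - pr i) := by
  classical
  have h := sum_outcomeProb_mul_ite pr (fun _ => False) (fun _ => True)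
  simp only [if_false, if_true, zero_add] at h
  rw [← h, avoidProb]
  refine Finset.sum_congr rfl fun B _ => ?_
  congr 1
  rcases B.eq_empty_or_nonempty with rfl | ⟨i, hi⟩
  · simp
  · have h0 : (0 : Fin 0 → ℝ) ∈ convexHull ℝ (w '' (B : Set (Fin n))) := by
      rw [Subsingleton.elim (0 : Fin 0 → ℝ) (w i)]
      exact subset_convexHull ℝ _ ⟨i, hi, rfl⟩
    rw [if_pos h0, if_neg]
    exact fun h => h.1 i hi

/-- On the line, `0` is avoided when all existing vectors are positive or all are negative. Only the
empty outcome is both, hence the subtraction. -/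
theorem avoidProb_one (w : Fin n → Fin 1 → ℝ) (hw : LinearGeneralPosition w) (pr : Fin n → ℝ) :
    avoidProb w pr = (∏ i, (if 0 < w i 0 then 1 else 1 - pr i)) +
      (∏ i, (if 0 < -w i 0 then 1 else 1 - pr i)) - ∏ i, (1 - pr i) := by
  classical
  have hne : ∀ i, w i 0 ≠ 0 := fun i h => by
    have := (hw 1 le_rfl (fun _ => i) (Function.injective_of_subsingleton _)).ne_zero 0
    exact this (by ext c; rw [Subsingleton.elim c 0]; exact h)
  have hp : ∀ a : Fin n → Prop, ∏ i, (if a i then 1 else 1 - pr i) =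
      ∑ B, outcomeProb pr B * (if (∀ i ∈ B, a i) ∧ ∀ i ∈ Bᶜ, True then 1 else 0) := by
    intro a
    rw [sum_outcomeProb_mul_ite]
    refine Finset.prod_congr rfl fun i _ => ?_
    split_ifs <;> simp
  have h0 := hp (fun _ => False)
  simp only [if_false] at h0
  rw [h0, hp (fun i => 0 < w i 0), hp (fun i => 0 < -w i 0), ← Finset.sum_add_distrib,
    ← Finset.sum_sub_distrib, avoidProb]
  refine Finset.sum_congr rfl fun B _ => ?_
  rw [← mul_add, ← mul_sub]
  congr 1
  simp only [implies_true, and_true]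
  rcases B.eq_empty_or_nonempty with rfl | ⟨i, hi⟩
  · simp
  have hf : ¬ ∀ i ∈ B, False := fun h => h i hi
  rw [if_neg hf, sub_zero]
  have key : ∀ s : ℝ, (∀ j ∈ B, 0 < s * w j 0) →
      (0 : Fin 1 → ℝ) ∉ convexHull ℝ (w '' (B : Set (Fin n))) := by
    intro s hs h
    obtain ⟨μ, hμ0, hμ1, hμ⟩ := mem_convexHull_image_iff.1 h
    have h1 := congr_arg (s * ·) (congr_fun hμ 0)
    simp only [Finset.sum_apply, Pi.smul_apply, smul_eq_mul, Pi.zero_apply, mul_zero,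
      Finset.mul_sum] at h1
    rw [Finset.sum_eq_zero_iff_of_nonneg] at h1
    · rw [Finset.sum_eq_zero] at hμ1
      · exact zero_ne_one hμ1
      · intro j hj
        have := h1 j hj
        rw [mul_left_comm] at this
        exact (mul_eq_zero.1 this).resolve_right (hs j hj).ne'
    · intro j hj
      rw [mul_left_comm]
      exact mul_nonneg (hμ0 j hj) (hs j hj).le
  by_cases hpos : ∀ j ∈ B, 0 < w j 0
  · have hneg : ¬ ∀ j ∈ B, 0 < -w j 0 := fun h => by
      have := hpos i hi
      have := h i hi
      linarith
    rw [if_pos hpos, if_neg hneg, if_neg (key 1 (by simpa using hpos)), add_zero]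
  · by_cases hneg : ∀ j ∈ B, 0 < -w j 0
    · rw [if_neg hpos, if_pos hneg, if_neg (key (-1) (by simpa using hneg)), zero_add]
    · rw [if_neg hpos, if_neg hneg, add_zero, if_pos]
      push Not at hpos hneg
      obtain ⟨j, hj, hj'⟩ := hpos
      obtain ⟨l, hl, hl'⟩ := hneg
      have hj0 : w j 0 < 0 := lt_of_le_of_ne hj' (hne j)
      have hl0 : 0 < w l 0 := lt_of_le_of_ne (by linarith) (hne l).symm
      refine segment_subset_convexHull (s := w '' (B : Set (Fin n))) (x := w j) (y := w l)
        ⟨j, hj, rfl⟩ ⟨l, hl, rfl⟩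
        ⟨w l 0 / (w l 0 - w j 0), -w j 0 / (w l 0 - w j 0), div_nonneg hl0.le (by linarith),
          div_nonneg (by linarith) (by linarith), ?_, ?_⟩
      · rw [← add_div, div_eq_one_iff_eq (by linarith)]; ring
      · ext c
        rw [Subsingleton.elim c 0]
        simp only [Pi.add_apply, Pi.smul_apply, smul_eq_mul, Pi.zero_apply]
        field_simp
        ring

open Classical in
-- Compare the indicators outcome by outcome. With an extreme facet, the hull avoids `0` while the
-- projected hull contains it, and uniqueness makes the sum equal to `1`. Without one, the two hulls
-- avoid `0` simultaneously.
theorem avoidProb_add_two {p : ℕ} (w : Fin n → Fin (p + 2) → ℝ) (hw : LinearGeneralPosition w)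
    (hx : LinearGeneralPosition (dropTwo w)) (pr : Fin n → ℝ) :
    avoidProb w pr = (∑ f : Fin (p + 1) → Fin n,
      if StrictMono f ∧ ∀ j, 0 < coneCoeff (dropTwo w) f j then
        ∏ i, (if ∃ j, f j = i then pr i else if 0 < sideFunctional w f (w i) then 1 else 1 - pr i)
      else 0) + avoidProb (dropTwo w) pr := by
  have hterm : ∀ f : Fin (p + 1) → Fin n,
      (if StrictMono f ∧ ∀ j, 0 < coneCoeff (dropTwo w) f j then
        ∏ i, (if ∃ j, f j = i then pr i else if 0 < sideFunctional w f (w i) then 1 else 1 - pr i)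
      else 0) = ∑ B : Finset (Fin n), outcomeProb pr B *
        if IsExtremeFacet w (B : Set (Fin n)) f then 1 else 0 := by
    intro f
    by_cases hf : StrictMono f ∧ ∀ j, 0 < coneCoeff (dropTwo w) f j
    · have h := sum_outcomeProb_mul_ite pr
        (fun i => (∃ j, f j = i) ∨ 0 < sideFunctional w f (w i)) (fun i => ¬ ∃ j, f j = i)
      rw [if_pos hf]
      convert h.symm using 1
      · refine Finset.prod_congr rfl fun i _ => ?_
        by_cases h1 : ∃ j, f j = i <;> by_cases h2 : 0 < sideFunctional w f (w i) <;> simp [h1, h2]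
      · refine Finset.sum_congr rfl fun B _ => ?_
        congr 1
        refine if_congr ⟨fun hB => ⟨fun i hi => ?_, fun i hi => ?_⟩, fun hB =>
          ⟨hf.1, hf.2, fun j => ?_, fun b hb hbf => ?_⟩⟩ rfl rfl
        · by_cases h1 : ∃ j, f j = i
          · exact Or.inl h1
          · push Not at h1
            exact Or.inr (hB.side_pos i hi h1)
        · rintro ⟨j, rfl⟩
          exact Finset.mem_compl.1 hi (hB.mem j)
        · by_contra hj
          exact hB.2 (f j) (Finset.mem_compl.2 hj) ⟨j, rfl⟩
        · exact (hB.1 b hb).resolve_left (fun ⟨j, hj⟩ => hbf j hj)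
    · rw [if_neg hf, Finset.sum_eq_zero]
      intro B _
      rw [if_neg (fun h => hf ⟨h.strictMono, h.coeff_pos⟩), mul_zero]
  simp only [hterm]
  rw [Finset.sum_comm, avoidProb, avoidProb, ← Finset.sum_add_distrib]
  refine Finset.sum_congr rfl fun B _ => ?_
  rw [← Finset.mul_sum, ← mul_add]
  congr 1
  by_cases hex : ∃ f, IsExtremeFacet w (B : Set (Fin n)) f
  · obtain ⟨f, hf⟩ := hex
    rw [if_neg (hf.zero_notMem hw), if_pos hf.zero_mem_dropTwo, Finset.sum_eq_single f, if_pos hf,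
      add_zero]
    · intro g _ hg
      rw [if_neg (fun h => hg (h.unique hf))]
    · simp
  · rw [Finset.sum_eq_zero (fun f _ => if_neg (fun h => hex ⟨f, h⟩)), zero_add]
    refine if_congr ⟨fun h => ?_, fun h => ?_⟩ rfl rfl
    · obtain ⟨μ, hμ0, hμ1, hμ⟩ := mem_convexHull_image_iff.1 h
      refine mem_convexHull_image_iff.2 ⟨μ, hμ0, hμ1, ?_⟩
      ext c
      simpa [dropTwo] using congr_fun hμ c.succ.succ
    · by_contra hcon
      exact hex (exists_isExtremeFacet hw hx h hcon)

end Probability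

/-! ### General position of the sheared vectors -/

section Shear

variable {n d : ℕ}

/-- The last `k` of `d` coordinates. -/
def lastCoord {k d : ℕ} (h : k ≤ d) (c : Fin k) : Fin d := ⟨d - k + c, by omega⟩

/-- The vectors from the query point to the sites, with the multiple by `t` of the last but one
coordinate added to the last one. -/
def shear (hd : 2 ≤ d) (site : Fin n → Fin d → ℝ) (q : Fin d → ℝ) (t : ℝ) (i : Fin n)
    (c : Fin d) : ℝ :=
  if (c : ℕ) = d - 1 then
    site i c - q c + t * (site i ⟨d - 2, by omega⟩ - q ⟨d - 2, by omega⟩)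
  else site i c - q c

/-- A multiple for which no vector has the last coordinate `0`. -/
noncomputable def shearParam (hd : 2 ≤ d) (site : Fin n → Fin d → ℝ) (q : Fin d → ℝ) : ℝ :=
  1 + ∑ i, (site i ⟨d - 1, by omega⟩ - q ⟨d - 1, by omega⟩) /
    (site i ⟨d - 2, by omega⟩ - q ⟨d - 2, by omega⟩) *
    ((site i ⟨d - 1, by omega⟩ - q ⟨d - 1, by omega⟩) /
    (site i ⟨d - 2, by omega⟩ - q ⟨d - 2, by omega⟩))

/-- The last `k` coordinates of the sheared vectors. -/
def lastShear (hd : 2 ≤ d) (site : Fin n → Fin d → ℝ) (q : Fin d → ℝ) (t : ℝ) {k : ℕ} (h : k ≤ d)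
    (i : Fin n) (c : Fin k) : ℝ :=
  shear hd site q t i (lastCoord h c)

theorem dropTwo_lastShear (hd : 2 ≤ d) (site : Fin n → Fin d → ℝ) (q : Fin d → ℝ) (t : ℝ) {p : ℕ}
    (h : p + 2 ≤ d) (h' : p ≤ d) :
    dropTwo (lastShear hd site q t h) = lastShear hd site q t h' := by
  ext i c
  simp only [dropTwo, lastShear]
  congr 1
  ext
  simp only [lastCoord, Fin.val_succ]
  omega

/-- The shear is an invertible linear map, so the same weights serve on both sides. -/
theorem mem_convexHull_iff_shear (hd : 2 ≤ d) (site : Fin n → Fin d → ℝ) (q : Fin d → ℝ) (t : ℝ)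
    (B : Finset (Fin n)) :
    q ∈ convexHull ℝ (site '' (B : Set (Fin n))) ↔
      (0 : Fin d → ℝ) ∈ convexHull ℝ (lastShear hd site q t le_rfl '' (B : Set (Fin n))) := by
  rw [mem_convexHull_image_iff, mem_convexHull_image_iff]
  refine exists_congr fun μ => and_congr_right fun _ => and_congr_right fun hμ => ?_
  have hsum : ∀ c, ∑ i ∈ B, μ i * (site i c - q c) = (∑ i ∈ B, μ i * site i c) - q c := fun c => by
    simp only [mul_sub, Finset.sum_sub_distrib, ← Finset.sum_mul, hμ, one_mul]
  have hsh : ∀ c, (∑ i ∈ B, μ i • lastShear hd site q t le_rfl i) c =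
      ((∑ i ∈ B, μ i * site i c) - q c) + if (c : ℕ) = d - 1 then
        t * ((∑ i ∈ B, μ i * site i ⟨d - 2, by omega⟩) - q ⟨d - 2, by omega⟩) else 0 := by
    intro c
    have hc : lastCoord le_rfl c = c := by ext; simp [lastCoord]
    simp only [Finset.sum_apply, Pi.smul_apply, smul_eq_mul, lastShear, hc, shear]
    split_ifs with h
    · rw [← hsum, ← hsum, Finset.mul_sum, ← Finset.sum_add_distrib]
      exact Finset.sum_congr rfl fun i _ => by ring
    · rw [hsum, add_zero]
  constructor
  · intro h
    have h' : ∀ c, ∑ i ∈ B, μ i * site i c = q c := fun c => by simpa using congr_fun h c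
    ext c
    rw [hsh]
    simp [h']
  · intro h
    have h' := fun c => (hsh c).symm.trans (congr_fun h c)
    have h2 := h' ⟨d - 2, by omega⟩
    rw [if_neg (by simp only; omega), add_zero, Pi.zero_apply] at h2
    ext c
    have hc := h' c
    simp only [h2, mul_zero, ite_self, add_zero, Pi.zero_apply] at hc
    simpa using sub_eq_zero.1 hc

theorem membershipProb_eq (hd : 2 ≤ d) (site : Fin n → Fin d → ℝ) (pr : Fin n → ℝ)
    (q : Fin d → ℝ) (t : ℝ) :
    membershipProb site pr q = 1 - avoidProb (lastShear hd site q t le_rfl) pr := by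
  classical
  rw [eq_sub_iff_add_eq, ← sum_outcomeProb pr, membershipProb, avoidProb, Finset.sum_filter,
    ← Finset.sum_add_distrib]
  refine Finset.sum_congr rfl fun B _ => ?_
  by_cases h : q ∈ convexHull ℝ (site '' (B : Set (Fin n)))
  · rw [if_pos h, if_pos ((mem_convexHull_iff_shear hd site q t B).1 h), mul_zero, add_zero]
  · rw [if_neg h, if_neg (fun h' => h ((mem_convexHull_iff_shear hd site q t B).2 h')), mul_one,
      zero_add]

/-- In general position, no nonzero linear functional of the last `p + 2` coordinates vanishes
at `p + 2` of the vectors from the query point. -/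
theorem GeneralPosition.eq_zero {site : Fin n → Fin d → ℝ} {q : Fin d → ℝ}
    (h : GeneralPosition (withQuery site q)) {p : ℕ} (hp : p + 2 ≤ d) {f : Fin (p + 2) → Fin n}
    (hf : f.Injective) {a : Fin (p + 2) → ℝ}
    (ha : ∀ j, ∑ c, a c * (site (f j) (lastCoord hp c) - q (lastCoord hp c)) = 0) : a = 0 := by
  by_contra hne
  refine h (p + 2) (by omega) hp
    ⟨lastCoord hp, fun i j hij => by simpa [lastCoord, Fin.ext_iff] using hij⟩
    ⟨(Fin.cons none (fun j => some (f j)) : Fin (p + 3) → Option (Fin n)), ?_⟩ a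
    (∑ c, a c * q (lastCoord hp c)) hne fun j => ?_
  · rw [Fin.cons_injective_iff]
    exact ⟨by simp, (Option.some_injective _).comp hf⟩
  · refine Fin.cases ?_ (fun j => ?_) j
    · rfl
    · have := ha j
      simp only [mul_sub, Finset.sum_sub_distrib, sub_eq_zero] at this
      exact this

theorem linearIndependent_lastShear (hd : 2 ≤ d) {site : Fin n → Fin d → ℝ} {q : Fin d → ℝ}
    (h : GeneralPosition (withQuery site q)) (t : ℝ) {p : ℕ} (hp : p + 2 ≤ d)
    {f : Fin (p + 2) → Fin n} (hf : f.Injective) :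
    LinearIndependent ℝ (lastShear hd site q t hp ∘ f) := by
  change LinearIndependent ℝ (Matrix.of (lastShear hd site q t hp ∘ f)).row
  rw [Matrix.linearIndependent_rows_iff_isUnit, Matrix.isUnit_iff_isUnit_det, isUnit_iff_ne_zero]
  intro hdet
  obtain ⟨a, ha0, ha⟩ := Matrix.exists_mulVec_eq_zero_iff.2 hdet
  set c₁ : Fin (p + 2) := Fin.last (p + 1)
  set c₂ : Fin (p + 2) := (Fin.last p).castSucc
  have hc : c₁ ≠ c₂ := by simp [c₁, c₂, Fin.ext_iff]
  have hl2 : lastCoord hp c₂ = ⟨d - 2, by omega⟩ := by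
    ext; simp only [lastCoord, c₂, Fin.val_castSucc, Fin.val_last]; omega
  have hsh : ∀ i c, lastShear hd site q t hp i c = (site i (lastCoord hp c) - q (lastCoord hp c)) +
      if c = c₁ then t * (site i (lastCoord hp c₂) - q (lastCoord hp c₂)) else 0 := by
    intro i c
    have : ((lastCoord hp c : ℕ) = d - 1) ↔ c = c₁ := by
      simp only [lastCoord, c₁, Fin.ext_iff, Fin.val_last]; omega
    rw [lastShear, shear, hl2]
    by_cases hcc : c = c₁
    · rw [if_pos (this.2 hcc), if_pos hcc]
    · rw [if_neg (fun h => hcc (this.1 h)), if_neg hcc, add_zero]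
  -- Pull the functional `a` back along the shear: the last but one coefficient gains `t` times the
  -- last.
  have hz := h.eq_zero hp hf (a := fun c => a c + if c = c₂ then t * a c₁ else 0) fun j => by
    have hj := congr_fun ha j
    simp only [Matrix.mulVec, dotProduct, Matrix.of_apply, Function.comp_apply, hsh, add_mul,
      ite_mul, zero_mul, Finset.sum_add_distrib, Finset.sum_ite_eq', Finset.mem_univ, if_true,
      Pi.zero_apply] at hj
    simp only [add_mul, ite_mul, zero_mul, Finset.sum_add_distrib, Finset.sum_ite_eq',
      Finset.mem_univ, if_true]
    rw [← hj]
    congr 1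
    · exact Finset.sum_congr rfl fun c _ => mul_comm _ _
    · ring
  refine ha0 ?_
  have h1 : a c₁ = 0 := by simpa [hc] using congr_fun hz c₁
  ext c
  simpa [h1] using congr_fun hz c

theorem shear_last_ne_zero (hd : 2 ≤ d) {site : Fin n → Fin d → ℝ} {q : Fin d → ℝ}
    (h : GeneralPosition (withQuery site q)) (hn : 2 ≤ n) (i : Fin n) :
    shear hd site q (shearParam hd site q) i ⟨d - 1, by omega⟩ ≠ 0 := by
  have hnt : Nontrivial (Fin n) := Fin.nontrivial_iff_two_le.2 hn
  obtain ⟨i', hi'⟩ := exists_ne i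
  have hli := linearIndependent_lastShear hd h 0 (p := 0) hd (f := ![i, i']) (by
    intro a b hab
    fin_cases a <;> fin_cases b <;> simp_all)
  have hne := hli.ne_zero 0
  set x := site i ⟨d - 1, by omega⟩ - q ⟨d - 1, by omega⟩ with hx
  set y := site i ⟨d - 2, by omega⟩ - q ⟨d - 2, by omega⟩ with hy
  have hxy : x ≠ 0 ∨ y ≠ 0 := by
    by_contra! hcon
    refine hne ?_
    have h0 : lastCoord hd 0 = ⟨d - 2, by omega⟩ := by ext; simp [lastCoord]
    have h1 : lastCoord hd 1 = ⟨d - 1, by omega⟩ := by ext; simp [lastCoord]; omega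
    have h2 : d - 2 ≠ d - 1 := by omega
    ext c
    fin_cases c
    · simpa [lastShear, shear, h0, h2] using hcon.2
    · simpa [lastShear, shear, h1] using hcon.1
  have ht : 1 + (x / y) * (x / y) ≤ shearParam hd site q := by
    unfold shearParam
    refine add_le_add_right ?_ _
    exact Finset.single_le_sum (f := fun i => (site i ⟨d - 1, by omega⟩ - q ⟨d - 1, by omega⟩) /
      (site i ⟨d - 2, by omega⟩ - q ⟨d - 2, by omega⟩) *
      ((site i ⟨d - 1, by omega⟩ - q ⟨d - 1, by omega⟩) /
      (site i ⟨d - 2, by omega⟩ - q ⟨d - 2, by omega⟩))) (fun i _ => mul_self_nonneg _)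
      (Finset.mem_univ i)
  rw [shear, if_pos rfl]
  change x + shearParam hd site q * y ≠ 0
  by_cases hy0 : y = 0
  · simpa [hy0] using hxy
  · intro h0
    have : x / y = -shearParam hd site q := by
      field_simp; linarith
    rw [this] at ht
    -- With `t` the parameter, `x / y = -t` would give `1 + t ^ 2 ≤ t`.
    nlinarith [sq_nonneg (shearParam hd site q - 1)]

/-- General position speaks only of full tuples, and there may be fewer than `k` sites. For `2 ≤ k`,
project to the last `min k n` coordinates, extend `f` to a full tuple there, and lift independence
back. The case `k = 1` is what the shear is for. -/
theorem linearGeneralPosition_lastShear (hd : 2 ≤ d) {site : Fin n → Fin d → ℝ} {q : Fin d → ℝ}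
    (h : GeneralPosition (withQuery site q)) (hn : 2 ≤ n) {k : ℕ} (hk : k ≤ d) :
    LinearGeneralPosition (lastShear hd site q (shearParam hd site q) hk) := by
  classical
  intro m hm f hf
  rcases Nat.eq_zero_or_pos m with rfl | hm0
  · exact linearIndependent_empty_type
  have hmn : m ≤ n := by simpa using Fintype.card_le_of_injective f hf
  rcases Nat.lt_or_ge k 2 with hk2 | hk2
  · obtain rfl : k = 1 := by omega
    obtain rfl : m = 1 := by omega
    rw [linearIndependent_unique_iff]
    intro h0
    refine shear_last_ne_zero hd h hn (f 0) ?_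
    have h1 := congr_fun h0 0
    simp only [Function.comp_apply, lastShear, Pi.zero_apply] at h1
    rw [← h1]
    congr 1
  obtain ⟨p, hp⟩ : ∃ p, min k n = p + 2 := ⟨min k n - 2, by omega⟩
  have hpd : p + 2 ≤ d := by omega
  have hpk : p + 2 ≤ k := by omega
  obtain ⟨T, hT, hcard⟩ := Finset.exists_superset_card_eq (s := Finset.univ.image f) (n := p + 2)
    (by rw [Finset.card_image_of_injective _ hf, Finset.card_fin]; omega) (by simp; omega)
  have hli := linearIndependent_lastShear hd h (shearParam hd site q) hpd
    (T.orderEmbOfFin hcard).injective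
  rw [← linearIndepOn_range_iff (T.orderEmbOfFin hcard).injective] at hli
  have hli' : LinearIndependent ℝ (lastShear hd site q (shearParam hd site q) hpd ∘ f) := by
    rw [← linearIndepOn_range_iff hf]
    refine hli.mono ?_
    rw [Finset.range_orderEmbOfFin]
    rintro _ ⟨j, rfl⟩
    exact hT (Finset.mem_image_of_mem _ (Finset.mem_univ j))
  refine LinearIndependent.of_comp (LinearMap.funLeft ℝ ℝ (lastCoord hpk)) ?_
  convert hli' using 1
  ext j c
  simp only [Function.comp_apply, LinearMap.funLeft_apply, lastShear]
  congr 1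
  ext
  simp only [lastCoord]
  omega

end Shear

end Unipoint

/-! ### The program -/

namespace RealRAM.Expr

open Unipoint

variable {d n a : ℕ} {site : Fin n → Fin d → ℝ} {pr : Fin n → ℝ} {q : Fin d → ℝ} {τ : ℝ}

theorem snoc_zero (ρ : Fin 0 → Fin n) (i : Fin n) :
    (Fin.snoc ρ i : Fin (0 + 1) → Fin n) 0 = i := by
  simp [Fin.snoc]

/-- Sum of a list of expressions. -/
def finSum : {k : ℕ} → (Fin k → Expr d a) → Expr d a
  | 0, _ => const 0
  | _ + 1, F => add (F 0) (finSum fun i => F i.succ)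

theorem eval_finSum {k : ℕ} (F : Fin k → Expr d a) (ρ : Fin a → Fin n) :
    eval site pr q τ (finSum F) ρ = ∑ i, eval site pr q τ (F i) ρ := by
  induction k with
  | zero => simp [finSum, eval]
  | succ k ih => rw [finSum, eval, ih, Fin.sum_univ_succ]

theorem depth_finSum {k : ℕ} (F : Fin k → Expr d a) (h : ∀ i, depth (F i) = 0) :
    depth (finSum F) = 0 := by
  induction k with
  | zero => rfl
  | succ k ih => simp [finSum, depth, h, ih]

/-- Determinant, by expansion along the first row. -/
def det : {k : ℕ} → (Fin k → Fin k → Expr d a) → Expr d a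
  | 0, _ => const 1
  | _ + 1, A => finSum fun c => mul (mul (const ((-1) ^ (c : ℕ))) (A 0 c))
      (det fun i j => A i.succ (c.succAbove j))

theorem eval_det {k : ℕ} (A : Fin k → Fin k → Expr d a) (ρ : Fin a → Fin n) :
    eval site pr q τ (det A) ρ = Matrix.det (Matrix.of fun i j => eval site pr q τ (A i j) ρ) := by
  induction k with
  | zero => simp [det, eval]
  | succ k ih =>
    rw [det, eval_finSum, Matrix.det_succ_row_zero]
    refine Finset.sum_congr rfl fun c _ => ?_
    simp only [eval, ih, Rat.cast_pow, Rat.cast_neg, Rat.cast_one, Matrix.of_apply]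
    rfl

theorem depth_det {k : ℕ} (A : Fin k → Fin k → Expr d a) (h : ∀ i j, depth (A i j) = 0) :
    depth (det A) = 0 := by
  induction k with
  | zero => rfl
  | succ k ih => exact depth_finSum _ fun c => by simp [depth, h, ih]

/-- Test whether all expressions of a list are positive. -/
def ifAllPos : {m : ℕ} → (Fin m → Expr d a) → Expr d a → Expr d a → Expr d a
  | 0, _, x, _ => x
  | _ + 1, F, x, y => ifPos (F 0) (ifAllPos (fun j => F j.succ) x y) y

open Classical in
theorem eval_ifAllPos {m : ℕ} (F : Fin m → Expr d a) (x y : Expr d a) (ρ : Fin a → Fin n) :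
    eval site pr q τ (ifAllPos F x y) ρ =
      if ∀ j, 0 < eval site pr q τ (F j) ρ then eval site pr q τ x ρ else eval site pr q τ y ρ := by
  induction m with
  | zero => simp [ifAllPos]
  | succ m ih =>
    rw [ifAllPos, eval, ih]
    simp only [Fin.forall_fin_succ, ← ite_and]

theorem depth_ifAllPos {m : ℕ} (F : Fin m → Expr d a) (x y : Expr d a) (h : ∀ j, depth (F j) = 0) :
    depth (ifAllPos F x y) ≤ max (depth x) (depth y) := by
  induction m with
  | zero => simp [ifAllPos]
  | succ m ih =>
    have := ih (fun j => F j.succ) fun j => h j.succ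
    simp only [ifAllPos, depth, h]; omega

/-- Test whether some expression of a list is positive. -/
def ifAnyPos : {m : ℕ} → (Fin m → Expr d a) → Expr d a → Expr d a → Expr d a
  | 0, _, _, y => y
  | _ + 1, F, x, y => ifPos (F 0) x (ifAnyPos (fun j => F j.succ) x y)

open Classical in
theorem eval_ifAnyPos {m : ℕ} (F : Fin m → Expr d a) (x y : Expr d a) (ρ : Fin a → Fin n) :
    eval site pr q τ (ifAnyPos F x y) ρ =
      if ∃ j, 0 < eval site pr q τ (F j) ρ then eval site pr q τ x ρ else eval site pr q τ y ρ := by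
  induction m with
  | zero => simp [ifAnyPos]
  | succ m ih =>
    rw [ifAnyPos, eval, ih]
    simp only [Fin.exists_fin_succ, ← ite_or]

theorem depth_ifAnyPos {m : ℕ} (F : Fin m → Expr d a) (x y : Expr d a) (h : ∀ j, depth (F j) = 0) :
    depth (ifAnyPos F x y) ≤ max (depth x) (depth y) := by
  induction m with
  | zero => simp [ifAnyPos]
  | succ m ih =>
    have := ih (fun j => F j.succ) fun j => h j.succ
    simp only [ifAnyPos, depth, h]; omega

/-- Test of a list of inequalities between site variables. -/
def ifAllLt : {m : ℕ} → (Fin m → Fin a) → (Fin m → Fin a) → Expr d a → Expr d a → Expr d a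
  | 0, _, _, x, _ => x
  | _ + 1, I, J, x, y => ifLt (I 0) (J 0) (ifAllLt (fun j => I j.succ) (fun j => J j.succ) x y) y

open Classical in
theorem eval_ifAllLt {m : ℕ} (I J : Fin m → Fin a) (x y : Expr d a) (ρ : Fin a → Fin n) :
    eval site pr q τ (ifAllLt I J x y) ρ =
      if ∀ j, ρ (I j) < ρ (J j) then eval site pr q τ x ρ else eval site pr q τ y ρ := by
  induction m with
  | zero => simp [ifAllLt]
  | succ m ih =>
    rw [ifAllLt, eval, ih]
    simp only [Fin.forall_fin_succ, ← ite_and]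

theorem depth_ifAllLt {m : ℕ} (I J : Fin m → Fin a) (x y : Expr d a) :
    depth (ifAllLt I J x y) ≤ max (depth x) (depth y) := by
  induction m with
  | zero => simp [ifAllLt]
  | succ m ih =>
    have := ih (fun j => I j.succ) (fun j => J j.succ)
    simp only [ifAllLt, depth]; omega

/-- Test whether a site variable equals one of a list of site variables. -/
def ifAnyEq : {m : ℕ} → (Fin m → Fin a) → Fin a → Expr d a → Expr d a → Expr d a
  | 0, _, _, _, y => y
  | _ + 1, I, b, x, y => ifEq (I 0) b x (ifAnyEq (fun j => I j.succ) b x y)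

open Classical in
theorem eval_ifAnyEq {m : ℕ} (I : Fin m → Fin a) (b : Fin a) (x y : Expr d a) (ρ : Fin a → Fin n) :
    eval site pr q τ (ifAnyEq I b x y) ρ =
      if ∃ j, ρ (I j) = ρ b then eval site pr q τ x ρ else eval site pr q τ y ρ := by
  induction m with
  | zero => simp [ifAnyEq]
  | succ m ih =>
    rw [ifAnyEq, eval, ih]
    simp only [Fin.exists_fin_succ, ← ite_or]

theorem depth_ifAnyEq {m : ℕ} (I : Fin m → Fin a) (b : Fin a) (x y : Expr d a) :
    depth (ifAnyEq I b x y) ≤ max (depth x) (depth y) := by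
  induction m with
  | zero => simp [ifAnyEq]
  | succ m ih =>
    have := ih (fun j => I j.succ)
    simp only [ifAnyEq, depth]; omega

/-- Sum over all values of the site variables. -/
def sumAll : {m : ℕ} → Expr d m → Expr d 0
  | 0, x => x
  | _ + 1, x => sumAll (sum x)

theorem eval_sumAll {m : ℕ} (x : Expr d m) (ρ : Fin 0 → Fin n) :
    eval site pr q τ (sumAll x) ρ = ∑ f : Fin m → Fin n, eval site pr q τ x f := by
  induction m with
  | zero => simp [sumAll, Subsingleton.elim ρ default]
  | succ m ih =>
    rw [sumAll, ih]
    simp only [eval]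
    rw [← Fintype.sum_prod_type', ← Equiv.sum_comp ((Equiv.prodComm _ _).trans
      (Fin.snocEquiv (n := m) fun _ => Fin n))]
    rfl

theorem depth_sumAll {m : ℕ} (x : Expr d m) : depth (sumAll x) = depth x + m := by
  induction m with
  | zero => rfl
  | succ m ih => rw [sumAll, ih, depth]; omega

/-- Difference of a coordinate of a site and of the query point. -/
def diff (i : Fin a) (c : Fin d) : Expr d a := sub (coord i c) (query c)

theorem depth_diff (i : Fin a) (c : Fin d) : depth (diff i c) = 0 := rfl

/-- Value of `shearParam`. -/
def shearParamExpr (hd : 2 ≤ d) : Expr d 0 :=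
  add (const 1) (sum (mul (div (diff 0 ⟨d - 1, by omega⟩) (diff 0 ⟨d - 2, by omega⟩))
    (div (diff 0 ⟨d - 1, by omega⟩) (diff 0 ⟨d - 2, by omega⟩))))

theorem eval_shearParamExpr (hd : 2 ≤ d) (ρ : Fin 0 → Fin n) :
    eval site pr q τ (shearParamExpr hd) ρ = shearParam hd site q := by
  simp only [shearParamExpr, eval, diff, snoc_zero, Rat.cast_one]
  rfl

/-- Coordinate of a sheared vector. -/
def shearExpr (hd : 2 ≤ d) (i : Fin a) (c : Fin d) : Expr d a :=
  if (c : ℕ) = d - 1 then add (diff i c) (mul param (diff i ⟨d - 2, by omega⟩)) else diff i c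

theorem eval_shearExpr (hd : 2 ≤ d) (i : Fin a) (c : Fin d) (ρ : Fin a → Fin n) :
    eval site pr q τ (shearExpr hd i c) ρ = shear hd site q τ (ρ i) c := by
  unfold shearExpr shear
  split_ifs <;> rfl

theorem depth_shearExpr (hd : 2 ≤ d) (i : Fin a) (c : Fin d) : depth (shearExpr hd i c) = 0 := by
  unfold shearExpr
  split_ifs <;> rfl

/-- Value of `minorCoeff`. -/
def minorExpr (hd : 2 ≤ d) {p : ℕ} (h : p + 2 ≤ d) (I : Fin (p + 1) → Fin a) (j : Fin (p + 1)) :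
    Expr d a :=
  mul (const ((-1) ^ (j : ℕ)))
    (det fun r c => shearExpr hd (I (j.succAbove r)) (lastCoord h c.succ.succ))

theorem eval_minorExpr (hd : 2 ≤ d) {p : ℕ} (h : p + 2 ≤ d) (I : Fin (p + 1) → Fin a)
    (j : Fin (p + 1)) (ρ : Fin a → Fin n) :
    eval site pr q τ (minorExpr hd h I j) ρ =
      minorCoeff (dropTwo (lastShear hd site q τ h)) (fun j => ρ (I j)) j := by
  simp only [minorExpr, eval, eval_det, eval_shearExpr, minorCoeff, Rat.cast_pow, Rat.cast_neg,
    Rat.cast_one]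
  rfl

theorem depth_minorExpr (hd : 2 ≤ d) {p : ℕ} (h : p + 2 ≤ d) (I : Fin (p + 1) → Fin a)
    (j : Fin (p + 1)) : depth (minorExpr hd h I j) = 0 := by
  simp [minorExpr, depth, depth_det, depth_shearExpr]

/-- Value of `sideFunctional`. -/
def sideExpr (hd : 2 ≤ d) {p : ℕ} (h : p + 2 ≤ d) (I : Fin (p + 1) → Fin a) (b : Fin a) :
    Expr d a :=
  mul (minorExpr hd h I 0)
    (det fun r c => shearExpr hd ((Fin.cons b I : Fin (p + 2) → Fin a) r) (lastCoord h c))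

theorem eval_sideExpr (hd : 2 ≤ d) {p : ℕ} (h : p + 2 ≤ d) (I : Fin (p + 1) → Fin a) (b : Fin a)
    (ρ : Fin a → Fin n) :
    eval site pr q τ (sideExpr hd h I b) ρ =
      sideFunctional (lastShear hd site q τ h) (fun j => ρ (I j))
        (lastShear hd site q τ h (ρ b)) := by
  simp only [sideExpr, eval, eval_minorExpr, eval_det, eval_shearExpr, sideFunctional_apply]
  congr 2
  ext r c
  refine Fin.cases ?_ (fun r => ?_) r <;> simp [lastShear]

theorem depth_sideExpr (hd : 2 ≤ d) {p : ℕ} (h : p + 2 ≤ d) (I : Fin (p + 1) → Fin a)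
    (b : Fin a) : depth (sideExpr hd h I b) = 0 := by
  simp [sideExpr, depth, depth_minorExpr, depth_det, depth_shearExpr]

/-- Probability that the chosen sites span the extreme facet. -/
def facetProbExpr (hd : 2 ≤ d) {p : ℕ} (h : p + 2 ≤ d) : Expr d (p + 1) :=
  prod (ifAnyEq Fin.castSucc (Fin.last (p + 1)) (prob (Fin.last (p + 1)))
    (ifPos (sideExpr hd h Fin.castSucc (Fin.last (p + 1))) (const 1)
      (sub (const 1) (prob (Fin.last (p + 1))))))

/-- Probability that there is an extreme facet. -/
def facetSumExpr (hd : 2 ≤ d) {p : ℕ} (h : p + 2 ≤ d) : Expr d 0 :=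
  sumAll (ifAllLt (fun j : Fin p => j.castSucc) (fun j => j.succ)
    (ifAllPos (fun j => mul (minorExpr hd h id 0) (minorExpr hd h id j))
      (facetProbExpr hd h) (const 0)) (const 0))

open Classical in
theorem eval_facetSumExpr (hd : 2 ≤ d) {p : ℕ} (h : p + 2 ≤ d) (ρ : Fin 0 → Fin n) :
    eval site pr q τ (facetSumExpr hd h) ρ = ∑ f : Fin (p + 1) → Fin n,
      if StrictMono f ∧ ∀ j, 0 < coneCoeff (dropTwo (lastShear hd site q τ h)) f j then
        ∏ i, (if ∃ j, f j = i then pr i else if 0 < sideFunctional (lastShear hd site q τ h) f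
          (lastShear hd site q τ h i) then 1 else 1 - pr i)
      else 0 := by
  rw [facetSumExpr, eval_sumAll]
  refine Finset.sum_congr rfl fun f _ => ?_
  simp only [eval_ifAllLt, eval_ifAllPos, facetProbExpr, eval, eval_ifAnyEq, eval_sideExpr,
    eval_minorExpr, Fin.snoc_castSucc, Fin.snoc_last, Rat.cast_zero, Rat.cast_one, id,
    ite_and, Fin.strictMono_iff_lt_succ, coneCoeff]

/-- There are `p + 1` nested sums around one product, hence depth `p + 2`; the determinants have
fixed size and contain no loops. -/
theorem depth_facetSumExpr (hd : 2 ≤ d) {p : ℕ} (h : p + 2 ≤ d) :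
    depth (facetSumExpr hd h) ≤ d := by
  have h1 : depth (facetProbExpr hd h) ≤ 1 := by
    rw [facetProbExpr, depth, Nat.add_le_add_iff_right]
    refine (depth_ifAnyEq _ _ _ _).trans ?_
    simp [depth, depth_sideExpr]
  have h2 : depth (ifAllPos (fun j => mul (minorExpr hd h id 0) (minorExpr hd h id j))
      (facetProbExpr hd h) (const 0)) ≤ 1 := by
    refine (depth_ifAllPos _ _ _ fun j => by simp [depth, depth_minorExpr]).trans ?_
    simpa [depth] using h1
  rw [facetSumExpr, depth_sumAll]
  have h3 := depth_ifAllLt (fun j : Fin p => j.castSucc) (fun j => j.succ)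
    (ifAllPos (fun j => mul (minorExpr hd h id 0) (minorExpr hd h id j))
      (facetProbExpr hd h) (const 0)) (const 0)
  have h4 : depth (const 0 : Expr d (p + 1)) = 0 := rfl
  omega

/-- Probability that no site exists. -/
def emptyProbExpr : Expr d 0 := prod (sub (const 1) (prob 0))

/-- Value of `avoidProb` for the last `k` coordinates. -/
def avoidExpr (hd : 2 ≤ d) : (k : ℕ) → k ≤ d → Expr d 0
  | 0, _ => emptyProbExpr
  | 1, h => sub (add
      (prod (ifPos (shearExpr hd 0 (lastCoord h 0)) (const 1) (sub (const 1) (prob 0))))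
      (prod (ifPos (sub (const 0) (shearExpr hd 0 (lastCoord h 0))) (const 1)
        (sub (const 1) (prob 0))))) emptyProbExpr
  | p + 2, h => add (facetSumExpr hd h) (avoidExpr hd p (by omega))

theorem eval_avoidExpr (hd : 2 ≤ d)
    (hgp : ∀ {k : ℕ} (h : k ≤ d), LinearGeneralPosition (lastShear hd site q τ h)) :
    ∀ (k : ℕ) (h : k ≤ d) (ρ : Fin 0 → Fin n),
      eval site pr q τ (avoidExpr hd k h) ρ = avoidProb (lastShear hd site q τ h) pr
  | 0, h, ρ => by
    simp only [avoidProb_zero, avoidExpr, emptyProbExpr, eval, snoc_zero, Rat.cast_one]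
  | 1, h, ρ => by
    simp only [avoidProb_one _ (hgp h), avoidExpr, emptyProbExpr, eval, snoc_zero, eval_shearExpr,
      Rat.cast_one, Rat.cast_zero, zero_sub, lastShear]
    rfl
  | p + 2, h, ρ => by
    have hdrop := dropTwo_lastShear hd site q τ h (by omega)
    rw [avoidExpr, eval, eval_avoidExpr hd hgp p, eval_facetSumExpr,
      avoidProb_add_two _ (hgp h) (by rw [hdrop]; exact hgp _)]
    simp only [hdrop]

theorem depth_avoidExpr (hd : 2 ≤ d) : ∀ (k : ℕ) (h : k ≤ d), depth (avoidExpr hd k h) ≤ d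
  | 0, h => by simp only [avoidExpr, emptyProbExpr, depth]; omega
  | 1, h => by
    simp only [avoidExpr, emptyProbExpr, depth, depth_shearExpr]; omega
  | p + 2, h => max_le (depth_facetSumExpr hd h) (depth_avoidExpr hd p _)

/-- Value of `membershipProb`. -/
def membershipExpr (hd : 2 ≤ d) : Expr d 0 :=
  ifOne (sum (ifAnyPos (fun c => mul (diff 0 c) (diff 0 c)) (const 0) (prob 0)))
    (sub (const 1) (avoidExpr hd d le_rfl))

theorem depth_membershipExpr (hd : 2 ≤ d) : depth (membershipExpr hd) ≤ d := by
  have h1 := depth_avoidExpr hd d le_rfl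
  have h2 := depth_ifAnyPos (fun c => mul (diff 0 c) (diff 0 c)) (const 0) (prob 0 : Expr d 1)
    fun c => by simp [depth, depth_diff]
  simp only [membershipExpr, depth] at h2 ⊢
  omega

end RealRAM.Expr

/-! ### The case of a single site -/

namespace Unipoint

open Classical in
theorem membershipProb_single {d : ℕ} (site : Fin 1 → Fin d → ℝ) (pr : Fin 1 → ℝ)
    (q : Fin d → ℝ) : membershipProb site pr q = if site 0 = q then pr 0 else 0 := by
  have hu : (Finset.univ : Finset (Finset (Fin 1))) = {∅, {0}} := by decide
  rw [membershipProb, Finset.sum_filter, hu, Finset.sum_pair (by decide)]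
  have hc : ({0} : Finset (Fin 1))ᶜ = ∅ := by decide
  simp [outcomeProb, eq_comm, hc]

end Unipoint

/-! ### Correctness and cost of the program -/

namespace RealRAM

open Unipoint

namespace Expr

theorem eval_membershipExpr {d n : ℕ} {site : Fin n → Fin d → ℝ} {pr : Fin n → ℝ} {q : Fin d → ℝ}
    (hd : 2 ≤ d) (hn : 1 ≤ n) (h : GeneralPosition (withQuery site q)) (ρ : Fin 0 → Fin n) :
    eval site pr q (shearParam hd site q) (membershipExpr hd) ρ = membershipProb site pr q := by
  classical
  rw [membershipExpr, eval]
  split_ifs with h1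
  · subst h1
    rw [membershipProb_single, eval, Fin.sum_univ_one]
    -- The program recognises `site 0 ≠ q` by a positive square of a coordinate difference.
    simp only [eval_ifAnyPos, eval, diff, snoc_zero, mul_self_pos, sub_ne_zero, Rat.cast_zero]
    by_cases he : site 0 = q
    · simp [he]
    · rw [if_neg he, if_pos (Function.ne_iff.1 he)]
  · rw [eval, eval_avoidExpr hd (fun hk => linearGeneralPosition_lastShear hd h (by omega) hk),
      membershipProb_eq hd site pr q (shearParam hd site q)]
    simp [eval]

end Expr

/-- The program that computes the membership probability. -/
def membershipProgram {d : ℕ} (hd : 2 ≤ d) : Program :=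
  .seq (.instr (.wconst 1 1)) (.seq (.instr (.wconst 2 (d + 1)))
    (.seq ((Expr.shearParamExpr hd).compile 1) (.seq (.instr (.rcopy 0 1))
      (.seq ((Expr.membershipExpr hd).compile 1) (.instr (.rcopy 0 1))))))

theorem runs_membershipProgram {d n M : ℕ} (hd : 2 ≤ d) (hn : 1 ≤ n)
    (hM : n * (d + 1) + d < M) {site : Fin n → Fin d → ℝ} {pr : Fin n → ℝ} {q : Fin d → ℝ}
    (h : GeneralPosition (withQuery site q)) {s : State} (hs : HoldsInput site pr q s) :
    Runs M (membershipProgram hd) s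
      (1 + (1 + (Expr.cost n (Expr.shearParamExpr hd) +
        (1 + (Expr.cost n (Expr.membershipExpr hd) + 1)))))
      (fun s' => s'.rreg 0 = membershipProb site pr q) := by
  have hM' : d + 1 < M := by nlinarith
  refine Runs.seq (Q' := fun s' => s' = _) (Runs.instr (by simp only [Instr.Ok]; omega) rfl) ?_
  rintro _ rfl
  refine Runs.seq (Q' := fun s' => s' = _) (Runs.instr (by simpa only [Instr.Ok]) rfl) ?_
  rintro _ rfl
  set s₀ := (Instr.wconst 2 (d + 1)).eval ((Instr.wconst 1 1).eval s) with hs₀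
  have ρ : Fin 0 → Fin n := Fin.elim0
  -- In the first pass the parameter is the unknown initial content of real register `0`; the value
  -- of `shearParamExpr` does not depend on it.
  have hc : Expr.Ctx site pr q (s₀.rreg 0) ρ s₀ := by
    refine ⟨⟨?_, ?_, ?_, ?_⟩, ?_, ?_, fun i => i.elim0, rfl⟩
    · simpa [hs₀, Instr.eval, State.setW] using hs.size
    · simpa [hs₀, Instr.eval, State.setW] using hs.site
    · simpa [hs₀, Instr.eval, State.setW] using hs.pr
    · simpa [hs₀, Instr.eval, State.setW] using hs.query
    · simp [hs₀, Instr.eval, State.setW]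
    · simp [hs₀, Instr.eval, State.setW]
  refine (Expr.runs_compile hM _ 1 ρ s₀ le_rfl hc).seq fun s₁ ⟨hf, h1⟩ => ?_
  rw [Expr.eval_shearParamExpr] at h1
  have hc₁ := hc.frame hf le_rfl
  refine Runs.seq (Q' := fun s' => s' = _) (Runs.instr trivial rfl) ?_
  rintro _ rfl
  have hc₂ : Expr.Ctx site pr q (shearParam hd site q) ρ ((Instr.rcopy 0 1).eval s₁) :=
    ⟨⟨hc₁.input.size, hc₁.input.site, hc₁.input.pr, hc₁.input.query⟩, hc₁.one, hc₁.stride,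
      hc₁.var, by simp [Instr.eval, State.setR, h1]⟩
  refine (Expr.runs_compile hM _ 1 ρ _ le_rfl hc₂).seq fun s₂ ⟨_, h2⟩ => Runs.instr trivial ?_
  rw [Expr.eval_membershipExpr hd hn h] at h2
  simp [Instr.eval, State.setR, h2]

end RealRAM

theorem mainTheorem2 (d : ℕ) (hd : 2 ≤ d) :
    ∃ (prog : RealRAM.Program) (C : ℕ),
      ∀ (n : ℕ), 1 ≤ n →
      ∀ (site : Fin n → Fin d → ℝ) (pr : Fin n → ℝ) (q : Fin d → ℝ),
        (∀ i, 0 < pr i ∧ pr i ≤ 1) →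
        Unipoint.GeneralPosition (Unipoint.withQuery site q) →
        ∀ s : RealRAM.State, RealRAM.HoldsInput site pr q s →
          ∃ (t : ℕ) (s' : RealRAM.State),
            RealRAM.Exec (C * n) prog s t s' ∧
            t ≤ C * n ^ d ∧
            s'.rreg 0 = Unipoint.membershipProb site pr q := by
  obtain ⟨K, hK⟩ := RealRAM.Expr.exists_cost_le (RealRAM.Expr.shearParamExpr hd)
  obtain ⟨K', hK'⟩ := RealRAM.Expr.exists_cost_le (RealRAM.Expr.membershipExpr hd)
  -- `K + K' + 4` bounds the time, with `4` for the instructions around the two compiled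
  -- expressions; `2 * (d + 1)` ensures `n * (d + 1) + d < C * n`.
  refine ⟨RealRAM.membershipProgram hd, K + K' + 4 + 2 * (d + 1), ?_⟩
  intro n hn site pr q _ hgp s hs
  obtain ⟨t, s', he, ht, hr⟩ := RealRAM.runs_membershipProgram hd hn
    (M := (K + K' + 4 + 2 * (d + 1)) * n) (by nlinarith) hgp hs
  refine ⟨t, s', he, ht.trans ?_, hr⟩
  have h1 : RealRAM.Expr.depth (RealRAM.Expr.shearParamExpr hd) ≤ d :=
    le_trans (by simp [RealRAM.Expr.shearParamExpr, RealRAM.Expr.depth, RealRAM.Expr.depth_diff])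
      (show 1 ≤ d by omega)
  have h2 := RealRAM.Expr.depth_membershipExpr hd
  have h3 := (hK n hn).trans (Nat.mul_le_mul_left K (Nat.pow_le_pow_right hn h1))
  have h4 := (hK' n hn).trans (Nat.mul_le_mul_left K' (Nat.pow_le_pow_right hn h2))
  have h5 : 1 ≤ n ^ d := Nat.one_le_pow _ _ hn
  nlinarith
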